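/- Let $F$ be a probability distribution on $[0,\infty)$ with $R:=\sup\{r\ge 0:\int_0^\infty e^{rx}\,dF(x)<\infty\}>0$, and let $U=\sum_{n\ge 0}F^{*n}$ be its renewal measure. Assume that the moment generating function $g(z)=\int_0^\infty e^{zx}\,dF(x)$, $\Re z<R$, has a meromorphic extension to $\mathbb C$, again denoted by $g$. We put $1/0=\infty$, and $1/(1-g)=0$ at the poles of $g$. **Lattice case.** Suppose that $F$ is supported by $\mathbb N=\{0,1,2,\dots\}$ and that $$\liminf_{r\to+\infty}\ \sup_{-\pi\le\theta\le\pi}\left|\frac{1}{e^{r}\,(1-g(r+i\theta))}\right|=0 .$$ Let $z_0,z_1,\dots,z_N$ (possibly $N=\infty$) be the solutions of $g(z)=1$ in the fundamental domain $\{-\pi<\Im z\le \pi\}$, in order of nondecreasing real part. Then $U$ is concentrated on $\mathbb N$ with a finite mass function $u$, and for every integer $k\ge 1$ $$u(k)=-\sum_{j=0}^{N}\operatorname{Res}\left(\frac{e^{-kz}}{1-g(z)};z_j\right),$$ and, if all these solutions are simple zeros of $g-1$, $$u(k)=\sum_{j=0}^{N}\frac{e^{-kz_j}}{g'(z_j)}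 .$$ The sums have the following meaning. For each $\rho$ there are finitely many solutions with $\Re z_j<\rho$; along every sequence $r_n\to\infty$ with $\sup_{|\theta|\le\pi}|e^{r_n}(1-g(r_n+i\theta))|^{-1}\to 0$ (such sequences exist) the partial sums over $\Re z_j<r_n$ converge to $u(k)$. In particular, the sum is the ordinary finite sum if $N<\infty$, and the sum of the ordered series whenever that series converges. For $k=0$ the same statements hold if moreover $\liminf_{r\to\infty}\sup_{|\theta|\le\pi}|1-g(r+i\theta)|^{-1}=0$, with sequences $r_n\to\infty$ such that $\sup_{|\theta|\le\pi}|1-g(r_n+i\theta)|^{-1}\to 0$ and no pole of $g$ lies on the segments $\Re z=r_n$, $|\Im z|\le\pi$. **Non-lattice case.** Suppose that $F$ is not supported by $h\mathbb N$ for any $h>0$, that $$\limsup_{\theta\to\pm\infty}\ \sup_{0\le r\le R_0}\left|\frac{1}{1-g(r+i\theta)}\right|<\infty\quad\text{for all }R_0>0,$$ that the (finitely or infinitely many) solutions $z_0=0,z_1,z_2,\dots$ of $g(z)=1$ in $\mathbb C$ are all real and simple zeros of $g-1$, and that $$\liminf_{r\to+\infty}\ \sup_{\theta\in\mathbb R}\left|\frac{1}{r\,(1-g(r+i\theta))}\right|=0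 .$$ Let $x_0\ge 0$ be such that $\sum_{j\ge 1}\left|\frac{e^{-xz_j}}{z_j\,g'(z_j)}\right|<\infty$ for all $x>x_0$. Then the restriction of $U$ to $(x_0,\infty)$ is absolutely continuous with nonnegative density $$u(x)=-\sum_{j\ge 0}\operatorname{Res}\left(\frac{e^{-xz}}{1-g(z)};z_j\right)=\sum_{j\ge 0}\frac{e^{-xz_j}}{g'(z_j)},\qquad x>x_0,$$ both series being absolutely convergent. In particular, if the convergence condition holds for all $x>0$, then $U$ has this density on $(0,\infty)$. -/

import Mathlib

open MeasureTheory Filter Topology Set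
open scoped ENNReal

noncomputable section

namespace Renewal

/-- The `n`-fold convolution power of the measure `F`; the power `0` is the unit mass at `0`. -/
def convPow (F : Measure ℝ) : ℕ → Measure ℝ
  | 0 => Measure.dirac 0
  | n + 1 => (convPow F n).conv F

/-- The renewal measure `∑ n ≥ 0, F^{*n}`. -/
def renewalMeasure (F : Measure ℝ) : Measure ℝ :=
  Measure.sum (convPow F)

/-- `R = sup {r ≥ 0 : ∫ e^{rx} dF(x) < ∞}`, possibly `+∞`. -/
def expRadius (F : Measure ℝ) : EReal :=
  sSup ((fun r : ℝ => (r : EReal)) ''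
    {r : ℝ | 0 ≤ r ∧ Integrable (fun x : ℝ => Real.exp (r * x)) F})

/-- `G` is the meromorphic extension to `ℂ` of the moment generating function
`g(z) = ∫ e^{zx} dF(x)`, `Re z < R`. Normal form only fixes the representative of the
meromorphic function: `G` is analytic off its poles and takes the value `0` at its poles, so that
`G z = 1` never holds at a pole. -/
structure IsMeromorphicExtension (F : Measure ℝ) (G : ℂ → ℂ) : Prop where
  meromorphic : MeromorphicNFOn G univ
  eq_mgf : ∀ z : ℂ, (z.re : EReal) < expRadius F →
    G z = ∫ x : ℝ, Complex.exp (z * (x : ℂ)) ∂F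

/-- The residue of `f` at `c`: the value of `(2πi)⁻¹ ∮ f` over all small circles around `c`. -/
def residue (f : ℂ → ℂ) (c : ℂ) : ℂ :=
  limUnder (𝓝[>] (0 : ℝ)) fun ρ : ℝ =>
    (2 * (Real.pi : ℂ) * Complex.I)⁻¹ * ∮ z in C(c, ρ), f z

/-- `F` is supported by `hℕ = {0, h, 2h, …}`. -/
def SupportedOnMultiples (F : Measure ℝ) (h : ℝ) : Prop :=
  F (range fun n : ℕ => h * (n : ℝ))ᶜ = 0

/-- `F` is lattice if it is supported by `hℕ` for some mesh `h > 0`. -/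
def IsLattice (F : Measure ℝ) : Prop :=
  ∃ h : ℝ, 0 < h ∧ SupportedOnMultiples F h

/-- The solutions of `G z = 1`. -/
def roots (G : ℂ → ℂ) : Set ℂ := {z | G z = 1}

/-- The solutions of `G z = 1` in the fundamental domain `-π < Im z ≤ π`, a set of representatives
modulo `2πi`. -/
def stripRoots (G : ℂ → ℂ) : Set ℂ :=
  {z | G z = 1 ∧ -Real.pi < z.im ∧ z.im ≤ Real.pi}

/-- `sup_{-π ≤ θ ≤ π} |1 / (e^{mr} (1 - G(r + iθ)))|` in `[0, ∞]`, with `1/0 = ∞`. -/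
def latticeSup (G : ℂ → ℂ) (m : ℕ) (r : ℝ) : ℝ≥0∞ :=
  ⨆ θ ∈ Icc (-Real.pi) Real.pi,
    ‖Complex.exp ((m : ℂ) * (r : ℂ)) * (1 - G ((r : ℂ) + (θ : ℂ) * Complex.I))‖ₑ⁻¹

/-- `sup_{θ ∈ ℝ} |1 / (r (1 - G(r + iθ)))|` in `[0, ∞]`, with `1/0 = ∞`. -/
def nonLatticeSup (G : ℂ → ℂ) (r : ℝ) : ℝ≥0∞ :=
  ⨆ θ : ℝ, ‖(r : ℂ) * (1 - G ((r : ℂ) + (θ : ℂ) * Complex.I))‖ₑ⁻¹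

/-- `limsup_{θ → ±∞} sup_{0 ≤ r ≤ R₀} |1 / (1 - G(r + iθ))| < ∞`, with `1/0 = ∞`. -/
def BoundedAtVerticalInfinity (G : ℂ → ℂ) (R₀ : ℝ) : Prop :=
  limsup (fun θ : ℝ => ⨆ r ∈ Icc (0 : ℝ) R₀,
    ‖1 - G ((r : ℂ) + (θ : ℂ) * Complex.I)‖ₑ⁻¹) (atBot ⊔ atTop) < ⊤

/-- `s` is the sum of `a z` over the (finitely or infinitely many) solutions `z` in the fundamental
domain, taken in order of nondecreasing real part.
There are finitely many solutions in each half-plane `Re z < ρ`; the sums over `Re z < r n` tend to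
`s` along every sequence of abscissae `r n → ∞` with `latticeSup G m (r n) → 0` (and there are such
sequences); if there are finitely many solutions, `s` is the finite sum; if there are infinitely
many, then `s` is the sum of the series over any enumeration with nondecreasing real parts for
which the series converges. -/
structure IsOrderedRootSum (G : ℂ → ℂ) (m : ℕ) (a : ℂ → ℂ) (s : ℂ) : Prop where
  finite_halfPlane : ∀ ρ : ℝ, {z | z ∈ stripRoots G ∧ z.re < ρ}.Finite
  exists_abscissae : ∃ r : ℕ → ℝ, Tendsto r atTop atTop ∧
    Tendsto (fun n => latticeSup G m (r n)) atTop (𝓝 0)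
  tendsto_of_abscissae : ∀ r : ℕ → ℝ, Tendsto r atTop atTop →
    Tendsto (fun n => latticeSup G m (r n)) atTop (𝓝 0) →
    Tendsto (fun n => ∑ᶠ z ∈ {z | z ∈ stripRoots G ∧ z.re < r n}, a z) atTop (𝓝 s)
  eq_of_finite : (stripRoots G).Finite → s = ∑ᶠ z ∈ stripRoots G, a z
  eq_of_tendsto : ∀ (z : ℕ → ℂ) (t : ℂ), Function.Injective z → range z = stripRoots G →
    Monotone (fun j => (z j).re) →
    Tendsto (fun n => ∑ j ∈ Finset.range n, a (z j)) atTop (𝓝 t) → t = s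

end Renewal

end

namespace Renewal

/-! For `Re z < 0` the geometric series gives `∫ e^{zx} dU = ∑ g(z)^n = 1 / (1 - g(z))`. Both
formulas come from integrating this function along a vertical line left of the origin, moving the
line to an abscissa `r` far to the right, and collecting a residue at each solution of `g = 1` that
is crossed. The assumptions on `1 / (1 - g)` make the integral over the far line small.

Lattice case: `g` has period `2πi`, and `2π u(k)` is the integral of `e^{-kz} / (1 - g(z))` over one
period of the line `Re z = -1` (`integral_vertical_eq_mass`). The horizontal sides of a period
rectangle cancel, so the residue theorem (`integral_vertical_sub_eq_sum_residue`) leaves only the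
far line, whose normalised integral is at most the supremum of the integrand
(`norm_sum_residue_sub_mass_le`).

Non-lattice case: `1 / (1 - g)` is not integrable along lines, so it is weighted with the entire
kernel `e^{-xz} (1 - e^{-pz}) (1 - e^{-qz}) / z²`. On the left, Fourier inversion turns the integral
into a second difference of `∫ (x - y)⁺ dU(y)` (`integral_boxKernel_left`). On the right, if `|1 /
(1 - g)| ≤ ε r`, then `∫ dθ / (r² + θ²) = π / r` bounds it by `4πε` (`integral_boxKernel_right`).
Hence the second difference is the sum of the kernel over the roots, weighted by `1 / g'`
(`hatMass_eq_tsum`). Dividing by `q` and letting `q → 0` gives `U(x, x + p]` as a root sum, which is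
the integral of `∑ e^{-tw} / g'(w)` over `[x, x + p]` (`measureReal_Ioc_eq_integral`). Positivity of
`U` makes this continuous density real and nonnegative. -/

/-! ### Cauchy's theorem on rectangles for meromorphic integrands -/

/-- The values of a meromorphic function at removable singularities are arbitrary. The normal form
repairs them and changes only a countable set, which line integrals do not see. -/
theorem exists_analytic_off_countable {f : ℂ → ℂ} (hf : Meromorphic f) :
    ∃ (g : ℂ → ℂ) (s : Set ℂ), s.Countable ∧ (∀ z ∉ s, f z = g z) ∧
      ∀ z, 0 ≤ meromorphicOrderAt f z → AnalyticAt ℂ g z := by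
  have hf' : MeromorphicOn f univ := hf.meromorphicOn
  refine ⟨toMeromorphicNFOn f univ, {z | AnalyticAt ℂ f z}ᶜ, hf.countable_compl_analyticAt,
    fun z hz => ?_, fun z hz => ?_⟩
  · have hz' : AnalyticAt ℂ f z := by simpa using hz
    rw [toMeromorphicNFOn_eq_toMeromorphicNFAt hf' (mem_univ z),
      toMeromorphicNFAt_eq_self.2 hz'.meromorphicNFAt]
  · rw [← (meromorphicNFOn_toMeromorphicNFOn f univ
      (mem_univ z)).meromorphicOrderAt_nonneg_iff_analyticAt,
      meromorphicOrderAt_congr (hf'.toMeromorphicNFOn_eq_self_on_nhdsNE (mem_univ z))]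
    exact hz

theorem ae_vertical_notMem {s : Set ℂ} (hs : s.Countable) (r : ℝ) :
    ∀ᵐ θ : ℝ, (r : ℂ) + θ * Complex.I ∉ s := by
  refine ((hs.preimage_of_injOn (f := fun θ : ℝ => (r : ℂ) + θ * Complex.I) ?_).ae_notMem volume)
  intro x _ y _ h
  simpa using h

theorem ae_horizontal_notMem {s : Set ℂ} (hs : s.Countable) (c : ℝ) :
    ∀ᵐ x : ℝ, (x : ℂ) + c * Complex.I ∉ s := by
  refine ((hs.preimage_of_injOn (f := fun x : ℝ => (x : ℂ) + c * Complex.I) ?_).ae_notMem volume)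
  intro x _ y _ h
  simpa using h

theorem intervalIntegrable_vertical {f : ℂ → ℂ} (hf : Meromorphic f) {r c d : ℝ}
    (h : ∀ y ∈ uIcc c d, 0 ≤ meromorphicOrderAt f ((r : ℂ) + y * Complex.I)) :
    IntervalIntegrable (fun y : ℝ => f ((r : ℂ) + y * Complex.I)) volume c d := by
  obtain ⟨g, s, hs, hfg, hg⟩ := exists_analytic_off_countable hf
  have hcont : ContinuousOn (fun y : ℝ => g ((r : ℂ) + y * Complex.I)) (uIcc c d) := by
    intro y hy
    exact (ContinuousAt.comp (f := fun y : ℝ => (r : ℂ) + y * Complex.I) (hg _ (h y hy)).continuousAt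
      (by fun_prop)).continuousWithinAt
  refine hcont.intervalIntegrable.congr_ae (ae_restrict_of_ae ?_)
  filter_upwards [ae_vertical_notMem hs r] with y hy
  exact (hfg _ hy).symm

/-- Cauchy's theorem for a rectangle and a meromorphic function without poles in it. -/
theorem integral_boundary_rect_eq_zero_of_meromorphic {f : ℂ → ℂ} (hf : Meromorphic f)
    {a b c d : ℝ} (hab : a ≤ b) (hcd : c ≤ d)
    (h : ∀ z : ℂ, a ≤ z.re → z.re ≤ b → c ≤ z.im → z.im ≤ d → 0 ≤ meromorphicOrderAt f z) :
    (∫ x : ℝ in a..b, f (x + c * Complex.I)) - (∫ x : ℝ in a..b, f (x + d * Complex.I)) +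
      Complex.I * (∫ y : ℝ in c..d, f (b + y * Complex.I)) -
      Complex.I * (∫ y : ℝ in c..d, f (a + y * Complex.I)) = 0 := by
  obtain ⟨g, s, hs, hfg, hg⟩ := exists_analytic_off_countable hf
  have hv : ∀ r : ℝ, ∫ y : ℝ in c..d, f (r + y * Complex.I) =
      ∫ y : ℝ in c..d, g (r + y * Complex.I) := fun r =>
    intervalIntegral.integral_congr_ae
      ((ae_vertical_notMem hs r).mono fun y hy _ => hfg _ hy)
  have hh : ∀ r : ℝ, ∫ x : ℝ in a..b, f (x + r * Complex.I) =
      ∫ x : ℝ in a..b, g (x + r * Complex.I) := fun r =>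
    intervalIntegral.integral_congr_ae
      ((ae_horizontal_notMem hs r).mono fun y hy _ => hfg _ hy)
  rw [hv, hv, hh, hh]
  have := Complex.integral_boundary_rect_eq_zero_of_differentiableOn g (⟨a, c⟩ : ℂ) (⟨b, d⟩ : ℂ) ?_
  · simpa using this
  · intro z hz
    simp only [uIcc_of_le hab, uIcc_of_le hcd, Complex.mem_reProdIm, mem_Icc] at hz
    exact (hg z (h z hz.1.1 hz.1.2 hz.2.1 hz.2.2)).differentiableAt.differentiableWithinAt

/-! ### Residues -/

/-- The normalised integrals of `f` over all small circles around `c` are equal to `a`. -/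
def HasResidue (f : ℂ → ℂ) (c a : ℂ) : Prop :=
  ∀ᶠ ρ in 𝓝[>] (0 : ℝ), CircleIntegrable f c ρ ∧
    (2 * (Real.pi : ℂ) * Complex.I)⁻¹ * (∮ z in C(c, ρ), f z) = a

theorem eventually_forall_mem_sphere {p : ℂ → Prop} {c : ℂ} (h : ∀ᶠ z in 𝓝[≠] c, p z) :
    ∀ᶠ ρ in 𝓝[>] (0 : ℝ), ∀ z ∈ Metric.sphere c ρ, p z := by
  rw [eventually_nhdsWithin_iff, Metric.eventually_nhds_iff] at h
  obtain ⟨ε, hε, h⟩ := h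
  filter_upwards [Ioo_mem_nhdsGT hε] with ρ hρ z hz
  rw [Metric.mem_sphere] at hz
  refine h (by rw [hz]; exact hρ.2) ?_
  rintro rfl
  simp only [dist_self] at hz
  exact hρ.1.ne hz

namespace HasResidue

variable {f g : ℂ → ℂ} {c a b : ℂ}

theorem residue_eq (h : HasResidue f c a) : residue f c = a := by
  refine Tendsto.limUnder_eq (tendsto_const_nhds.congr' ?_)
  filter_upwards [h] with ρ hρ
  exact hρ.2.symm

theorem congr (h : HasResidue f c a) (hfg : f =ᶠ[𝓝[≠] c] g) : HasResidue g c a := by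
  filter_upwards [h, eventually_forall_mem_sphere hfg, self_mem_nhdsWithin] with ρ hρ hs hpos
  have hpos' : (0 : ℝ) < ρ := hpos
  refine ⟨(circleIntegrable_congr ?_).1 hρ.1, ?_⟩
  · intro z hz
    rw [abs_of_pos hpos'] at hz
    exact hs z hz
  · rw [← hρ.2, circleIntegral.integral_congr hpos'.le fun z hz => hs z hz]

theorem add (hf : HasResidue f c a) (hg : HasResidue g c b) :
    HasResidue (fun z => f z + g z) c (a + b) := by
  filter_upwards [hf, hg] with ρ h1 h2
  refine ⟨h1.1.add h2.1, ?_⟩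
  rw [circleIntegral.integral_add h1.1 h2.1, mul_add, h1.2, h2.2]

theorem const_mul (hf : HasResidue f c a) (k : ℂ) : HasResidue (fun z => k * f z) c (k * a) := by
  filter_upwards [hf] with ρ h1
  refine ⟨h1.1.const_smul (a := k), ?_⟩
  rw [circleIntegral.integral_const_mul, ← h1.2]
  ring

theorem sub (hf : HasResidue f c a) (hg : HasResidue g c b) :
    HasResidue (fun z => f z - g z) c (a - b) := by
  simpa [sub_eq_add_neg] using hf.add (hg.const_mul (-1))

theorem of_analyticAt (hf : AnalyticAt ℂ f c) : HasResidue f c 0 := by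
  obtain ⟨ε, hε, h⟩ := Metric.eventually_nhds_iff_ball.1 hf.eventually_analyticAt
  filter_upwards [Ioo_mem_nhdsGT hε] with ρ hρ
  have hsub : Metric.closedBall c ρ ⊆ Metric.ball c ε := Metric.closedBall_subset_ball hρ.2
  have hd : DifferentiableOn ℂ f (Metric.closedBall c ρ) := fun z hz =>
    (h z (hsub hz)).differentiableAt.differentiableWithinAt
  refine ⟨(hd.continuousOn.mono Metric.sphere_subset_closedBall).circleIntegrable hρ.1.le, ?_⟩
  rw [(hd.diffContOnCl_ball subset_rfl).circleIntegral_eq_zero hρ.1.le, mul_zero]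

theorem sum {ι : Type*} (s : Finset ι) {f : ι → ℂ → ℂ} {a : ι → ℂ}
    (h : ∀ i ∈ s, HasResidue (f i) c (a i)) :
    HasResidue (fun z => ∑ i ∈ s, f i z) c (∑ i ∈ s, a i) := by
  classical
  induction s using Finset.induction_on with
  | empty => simpa using of_analyticAt (c := c) (f := fun _ => (0 : ℂ)) analyticAt_const
  | insert i s hi ih =>
    simp only [Finset.sum_insert hi]
    exact (h i (Finset.mem_insert_self i s)).add
      (ih fun j hj => h j (Finset.mem_insert_of_mem hj))

theorem of_hasDerivAt {F : ℂ → ℂ} (h : ∀ᶠ z in 𝓝[≠] c, HasDerivAt F (f z) z ∧ ContinuousAt f z) :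
    HasResidue f c 0 := by
  filter_upwards [eventually_forall_mem_sphere h, self_mem_nhdsWithin] with ρ hs hpos
  have hpos' : (0 : ℝ) < ρ := hpos
  refine ⟨ContinuousOn.circleIntegrable hpos'.le fun z hz => (hs z hz).2.continuousWithinAt, ?_⟩
  rw [circleIntegral.integral_eq_zero_of_hasDerivWithinAt hpos'.le
    fun z hz => (hs z hz).1.hasDerivWithinAt, mul_zero]

theorem sub_inv (c : ℂ) : HasResidue (fun z => (z - c)⁻¹) c 1 := by
  filter_upwards [self_mem_nhdsWithin] with ρ hpos
  have hpos' : (0 : ℝ) < ρ := hpos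
  refine ⟨?_, ?_⟩
  · rw [circleIntegrable_sub_inv_iff]
    right
    simp [eq_comm (a := (0 : ℝ)), hpos'.ne']
  · rw [circleIntegral.integral_sub_center_inv c hpos'.ne']
    exact inv_mul_cancel₀ Complex.two_pi_I_ne_zero

end HasResidue

theorem _root_.AnalyticAt.dslope {k : ℂ → ℂ} {w : ℂ} (hk : AnalyticAt ℂ k w) :
    AnalyticAt ℂ (dslope k w) w := by
  obtain ⟨p, hp⟩ := hk
  exact ⟨_, hp.has_fpower_series_dslope_fslope⟩

/-- `k z / (z - w) = k w / (z - w) + dslope k w z`, and the last term is analytic. -/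
theorem HasResidue.div_sub {k : ℂ → ℂ} {w : ℂ} (hk : AnalyticAt ℂ k w) :
    HasResidue (fun z => k z / (z - w)) w (k w) := by
  have h := ((HasResidue.sub_inv w).const_mul (k w)).add (HasResidue.of_analyticAt hk.dslope)
  rw [mul_one, add_zero] at h
  refine h.congr ?_
  filter_upwards [self_mem_nhdsWithin] with z hz
  have hz' : z - w ≠ 0 := sub_ne_zero.2 hz
  rw [dslope_of_ne _ hz, slope_def_field]
  field_simp
  ring

/-- Induction on the pole order: subtracting the right multiple of `b N` makes the numerator vanish
at `w`, and `dslope` then divides out one factor `z - w`. The family `b` is left free so that it can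
be either the negative powers of `z - w` or the periodic poles. -/
theorem exists_principalPart {w : ℂ} (b B : ℕ → ℂ → ℂ) (hB : ∀ n, AnalyticAt ℂ (B n) w)
    (hB0 : ∀ n, B n w ≠ 0)
    (hb : ∀ n, ∀ᶠ z in 𝓝[≠] w, b n z = B n z / (z - w) ^ (n + 1)) (N : ℕ) :
    ∀ f g : ℂ → ℂ, AnalyticAt ℂ g w → (∀ᶠ z in 𝓝[≠] w, f z = g z / (z - w) ^ N) →
      ∃ (a : ℕ → ℂ) (ψ : ℂ → ℂ), AnalyticAt ℂ ψ w ∧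
        ∀ᶠ z in 𝓝[≠] w, f z - ∑ n ∈ Finset.range N, a n * b n z = ψ z := by
  induction N with
  | zero =>
    intro f g hg hf
    exact ⟨0, g, hg, by simpa using hf⟩
  | succ N ih =>
    intro f g hg hf
    set α : ℂ := g w / B N w with hα
    set k : ℂ → ℂ := fun z => g z - α * B N z with hk
    have hka : AnalyticAt ℂ k w := hg.sub (analyticAt_const.mul (hB N))
    have hkw : k w = 0 := by
      simp only [hk, hα]
      rw [div_mul_cancel₀ _ (hB0 N), sub_self]
    obtain ⟨a, ψ, hψ, ha⟩ := ih (fun z => f z - α * b N z) (dslope k w) hka.dslope (by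
      filter_upwards [hf, hb N, self_mem_nhdsWithin] with z h1 h2 hz
      have hz' : z - w ≠ 0 := sub_ne_zero.2 hz
      rw [h1, h2, dslope_of_ne _ hz, slope_def_field, hkw]
      simp only [hk]
      field_simp
      ring)
    refine ⟨Function.update a N α, ψ, hψ, ?_⟩
    filter_upwards [ha] with z hz
    rw [← hz, Finset.sum_range_succ, Function.update_self]
    rw [Finset.sum_congr rfl fun n hn => by
      rw [Function.update_of_ne (Finset.mem_range.1 hn).ne]]
    ring

theorem _root_.MeromorphicAt.exists_eq_div_pow {f : ℂ → ℂ} {w : ℂ} (hf : MeromorphicAt f w) :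
    ∃ (N : ℕ) (g : ℂ → ℂ), AnalyticAt ℂ g w ∧ ∀ᶠ z in 𝓝[≠] w, f z = g z / (z - w) ^ N := by
  obtain ⟨N, hN⟩ := hf
  refine ⟨N, _, hN, ?_⟩
  filter_upwards [self_mem_nhdsWithin] with z hz
  have hz' : z - w ≠ 0 := sub_ne_zero.2 hz
  rw [smul_eq_mul]
  field_simp

/-- Shows that the limit in `residue` is a true one: the circle integrals are eventually constant.
In the principal part every power except `(z - w)⁻¹` has a primitive. -/
theorem HasResidue.of_meromorphicAt {f : ℂ → ℂ} {w : ℂ} (hf : MeromorphicAt f w) :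
    HasResidue f w (residue f w) := by
  obtain ⟨N, g, hg, hfg⟩ := hf.exists_eq_div_pow
  obtain ⟨a, ψ, hψ, ha⟩ := exists_principalPart (w := w) (fun n z => 1 / (z - w) ^ (n + 1))
    (fun _ _ => 1) (fun _ => analyticAt_const) (fun _ => one_ne_zero)
    (fun _ => Eventually.of_forall fun _ => rfl) N f g hg hfg
  have hb : ∀ n : ℕ, ∃ r, HasResidue (fun z => 1 / (z - w) ^ (n + 1)) w r := by
    intro n
    rcases Nat.eq_zero_or_pos n with rfl | hn
    · exact ⟨1, by simpa using HasResidue.sub_inv w⟩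
    · refine ⟨0, HasResidue.of_hasDerivAt (F := fun z => -(1 / n) * (1 / (z - w) ^ n)) ?_⟩
      filter_upwards [self_mem_nhdsWithin] with z hz
      have hz' : z - w ≠ 0 := sub_ne_zero.2 hz
      have hn' : (n : ℂ) ≠ 0 := by exact_mod_cast hn.ne'
      refine ⟨?_, ContinuousAt.div continuousAt_const (by fun_prop) (pow_ne_zero _ hz')⟩
      have h := ((((hasDerivAt_id z).sub_const w).pow n).inv (pow_ne_zero n hz')).const_mul
        (-(1 / (n : ℂ)))
      simp only [id, Pi.inv_apply] at h
      refine (h.congr_deriv ?_).congr_of_eventuallyEq (Eventually.of_forall fun y => by simp)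
      obtain ⟨m, rfl⟩ := Nat.exists_eq_succ_of_ne_zero hn.ne'
      simp only [Nat.succ_eq_add_one, Nat.add_sub_cancel, mul_one, Pi.pow_apply]
      field_simp
      ring
  choose r hr using hb
  have h := (HasResidue.sum (Finset.range N) fun n _ => (hr n).const_mul (a n)).add
    (HasResidue.of_analyticAt hψ)
  have h' : HasResidue f w _ := h.congr (by
    filter_upwards [ha] with z hz
    rw [← hz]
    ring)
  rwa [h'.residue_eq]

/-! ### Periodic principal parts -/

/-- A function of period `2πi` with a pole of order `n + 1` at the points of `w + 2πiℤ`. -/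
noncomputable def periodicPole (w : ℂ) (n : ℕ) (z : ℂ) : ℂ :=
  Complex.exp z / (Complex.exp z - Complex.exp w) ^ (n + 1)

theorem periodicPole_periodic (w : ℂ) (n : ℕ) (z : ℂ) :
    periodicPole w n (z + 2 * Real.pi * Complex.I) = periodicPole w n z := by
  simp only [periodicPole, Complex.exp_periodic z]

theorem periodicPole_meromorphic (w : ℂ) (n : ℕ) : Meromorphic (periodicPole w n) := by
  have h : Meromorphic Complex.exp := fun z => analyticAt_cexp.meromorphicAt
  have : periodicPole w n = Complex.exp / (Complex.exp - fun _ => Complex.exp w) ^ (n + 1) := by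
    ext z; simp [periodicPole]
  rw [this]
  exact h.div ((h.sub (fun z => analyticAt_const.meromorphicAt)).pow)

theorem periodicPole_analyticAt {w z : ℂ} (n : ℕ) (h : Complex.exp z ≠ Complex.exp w) :
    AnalyticAt ℂ (periodicPole w n) z :=
  analyticAt_cexp.div ((analyticAt_cexp.sub analyticAt_const).pow _)
    (pow_ne_zero _ (sub_ne_zero.2 h))

theorem dslope_cexp_self (w : ℂ) : dslope Complex.exp w w = Complex.exp w := by
  rw [dslope_same, Complex.deriv_exp]

/-- The analytic factor of `periodicPole w n` at `w`. -/
noncomputable def periodicPoleFactor (w : ℂ) (n : ℕ) (z : ℂ) : ℂ :=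
  Complex.exp z / dslope Complex.exp w z ^ (n + 1)

theorem periodicPoleFactor_analyticAt (w : ℂ) (n : ℕ) :
    AnalyticAt ℂ (periodicPoleFactor w n) w :=
  analyticAt_cexp.div (analyticAt_cexp.dslope.pow _)
    (pow_ne_zero _ (by rw [dslope_cexp_self]; exact Complex.exp_ne_zero _))

theorem periodicPoleFactor_self_ne_zero (w : ℂ) (n : ℕ) : periodicPoleFactor w n w ≠ 0 := by
  rw [periodicPoleFactor, dslope_cexp_self]
  exact div_ne_zero (Complex.exp_ne_zero _) (pow_ne_zero _ (Complex.exp_ne_zero _))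

theorem periodicPole_eq_div (w : ℂ) (n : ℕ) :
    ∀ᶠ z in 𝓝[≠] w, periodicPole w n z = periodicPoleFactor w n z / (z - w) ^ (n + 1) := by
  filter_upwards [self_mem_nhdsWithin] with z hz
  have hz' : z - w ≠ 0 := sub_ne_zero.2 hz
  rw [periodicPole, periodicPoleFactor, div_div, ← mul_pow, dslope_of_ne _ hz, slope_def_field,
    div_mul_cancel₀ _ hz']

/-- The numerator `exp z` provides a primitive that is again periodic. For `n ≠ 0` this kills both
the residue and the integral over a period, so only `n = 0` contributes. -/
theorem hasDerivAt_periodicPole {w z : ℂ} {n : ℕ} (hn : n ≠ 0)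
    (h : Complex.exp z ≠ Complex.exp w) :
    HasDerivAt (fun z => -(1 / (n : ℂ)) * ((Complex.exp z - Complex.exp w) ^ n)⁻¹)
      (periodicPole w n z) z := by
  have hz' : Complex.exp z - Complex.exp w ≠ 0 := sub_ne_zero.2 h
  have hn' : (n : ℂ) ≠ 0 := by exact_mod_cast hn
  have h := ((((Complex.hasDerivAt_exp z).sub_const (Complex.exp w)).pow n).inv
    (pow_ne_zero n hz')).const_mul (-(1 / (n : ℂ)))
  refine (h.congr_deriv ?_).congr_of_eventuallyEq (Eventually.of_forall fun y => by simp)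
  obtain ⟨m, rfl⟩ := Nat.exists_eq_succ_of_ne_zero hn
  simp only [Nat.succ_eq_add_one, Nat.add_sub_cancel, periodicPole, Pi.pow_apply]
  field_simp
  ring

theorem eventually_cexp_ne (w : ℂ) : ∀ᶠ z in 𝓝[≠] w, Complex.exp z ≠ Complex.exp w :=
  (Complex.hasDerivAt_exp w).eventually_ne (Complex.exp_ne_zero w)

theorem hasResidue_periodicPole (w : ℂ) (n : ℕ) :
    HasResidue (periodicPole w n) w (if n = 0 then 1 else 0) := by
  split_ifs with hn
  · subst hn
    have h := HasResidue.div_sub (periodicPoleFactor_analyticAt w 0)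
    have h1 : periodicPoleFactor w 0 w = 1 := by
      rw [periodicPoleFactor, dslope_cexp_self, zero_add, pow_one,
        div_self (Complex.exp_ne_zero _)]
    rw [h1] at h
    refine h.congr ?_
    filter_upwards [periodicPole_eq_div w 0] with z hz
    rw [hz, zero_add, pow_one]
  · refine HasResidue.of_hasDerivAt
      (F := fun z => -(1 / (n : ℂ)) * ((Complex.exp z - Complex.exp w) ^ n)⁻¹) ?_
    filter_upwards [eventually_cexp_ne w] with z hz
    exact ⟨hasDerivAt_periodicPole hn hz, (periodicPole_analyticAt n hz).continuousAt⟩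

theorem cexp_vertical_ne {w : ℂ} {r : ℝ} (h : r ≠ w.re) (θ : ℝ) :
    Complex.exp (r + θ * Complex.I) ≠ Complex.exp w := by
  intro h'
  apply h
  have := congrArg (fun z : ℂ => ‖z‖) h'
  simpa [Complex.norm_exp] using this

theorem integral_periodicPole_of_ne_zero {w : ℂ} {r : ℝ} {n : ℕ} (hn : n ≠ 0) (h : r ≠ w.re) :
    ∫ θ in (-Real.pi)..Real.pi, periodicPole w n (r + θ * Complex.I) = 0 := by
  have hd : ∀ θ : ℝ, HasDerivAt (fun θ : ℝ => -Complex.I * (-(1 / (n : ℂ)) *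
      ((Complex.exp (r + θ * Complex.I) - Complex.exp w) ^ n)⁻¹))
      (periodicPole w n (r + θ * Complex.I)) θ := by
    intro θ
    have h1 : HasDerivAt (fun θ : ℝ => (r : ℂ) + θ * Complex.I) Complex.I θ := by
      simpa using ((Complex.ofRealCLM.hasDerivAt (x := θ)).mul_const Complex.I).const_add (r : ℂ)
    have h2 := ((hasDerivAt_periodicPole hn (cexp_vertical_ne h θ)).comp_of_eq θ h1 rfl).const_mul
      (-Complex.I)
    refine h2.congr_deriv ?_
    linear_combination (-periodicPole w n (r + θ * Complex.I)) * Complex.I_mul_I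
  rw [intervalIntegral.integral_eq_sub_of_hasDerivAt fun θ _ => hd θ]
  · have : ((r : ℂ) + (Real.pi : ℝ) * Complex.I) =
        ((r : ℂ) + ((-Real.pi : ℝ) : ℂ) * Complex.I) + 2 * Real.pi * Complex.I := by
      push_cast; ring
    rw [this, Complex.exp_periodic, sub_self]
  · refine ContinuousOn.intervalIntegrable fun θ _ => ?_
    exact (ContinuousAt.comp (f := fun y : ℝ => (r : ℂ) + y * Complex.I)
      (periodicPole_analyticAt n (cexp_vertical_ne h θ)).continuousAt
      (by fun_prop)).continuousWithinAt

/-- The substitution `ζ = e^z` wraps a period of the line onto the circle `|ζ| = e^r`. The jump of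
the integral across `Re w` is then Cauchy's formula for `e^w` outside or inside the circle. -/
theorem integral_periodicPole_zero (w : ℂ) (r : ℝ) :
    ∫ θ in (-Real.pi)..Real.pi, periodicPole w 0 (r + θ * Complex.I) =
      -Complex.I * ∮ z in C(0, Real.exp r), (z - Complex.exp w)⁻¹ := by
  have hper : Function.Periodic (fun θ : ℝ => periodicPole w 0 (r + θ * Complex.I))
      (2 * Real.pi) := by
    intro θ
    simp only
    rw [← periodicPole_periodic w 0 ((r : ℂ) + θ * Complex.I)]
    congr 1
    push_cast
    ring
  have h1 := hper.intervalIntegral_add_eq (-Real.pi) 0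
  have e1 : -Real.pi + 2 * Real.pi = Real.pi := by ring
  rw [e1, zero_add] at h1
  rw [h1, circleIntegral, ← intervalIntegral.integral_const_mul]
  refine intervalIntegral.integral_congr fun θ _ => ?_
  simp only [deriv_circleMap, circleMap, zero_add, smul_eq_mul, periodicPole, pow_one,
    Complex.exp_add, Complex.ofReal_exp]
  linear_combination ((Complex.exp r * Complex.exp (θ * Complex.I)) /
    (Complex.exp r * Complex.exp (θ * Complex.I) - Complex.exp w)) * Complex.I_mul_I

theorem integral_periodicPole_of_lt {w : ℂ} {r : ℝ} (h : r < w.re) :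
    ∫ θ in (-Real.pi)..Real.pi, periodicPole w 0 (r + θ * Complex.I) = 0 := by
  rw [integral_periodicPole_zero]
  have hd : DifferentiableOn ℂ (fun z => (z - Complex.exp w)⁻¹)
      (Metric.closedBall 0 (Real.exp r)) := by
    intro z hz
    refine (DifferentiableAt.inv (by fun_prop) ?_).differentiableWithinAt
    rw [sub_ne_zero]
    rintro rfl
    rw [mem_closedBall_zero_iff, Complex.norm_exp, Real.exp_le_exp] at hz
    exact absurd hz (not_le.2 h)
  rw [(hd.diffContOnCl_ball subset_rfl).circleIntegral_eq_zero (Real.exp_pos r).le, mul_zero]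

theorem integral_periodicPole_of_gt {w : ℂ} {r : ℝ} (h : w.re < r) :
    ∫ θ in (-Real.pi)..Real.pi, periodicPole w 0 (r + θ * Complex.I) = 2 * Real.pi := by
  rw [integral_periodicPole_zero, circleIntegral.integral_sub_inv_of_mem_ball]
  · linear_combination (-2 * Real.pi : ℂ) * Complex.I_mul_I
  · rw [mem_ball_zero_iff, Complex.norm_exp, Real.exp_lt_exp]
    exact h

/-! ### The residue theorem for periodic functions on a strip -/

theorem meromorphicOrderAt_add_period {f : ℂ → ℂ} {c : ℂ} (hper : ∀ z, f (z + c) = f z) (z : ℂ) :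
    meromorphicOrderAt f (z + c) = meromorphicOrderAt f z := by
  have h := meromorphicOrderAt_comp_add_const_eq_meromorphicOrderAt (f := f) (x := z) (c := c)
  rw [← h]
  congr 1
  ext y
  exact hper y

/-- The fundamental domain omits the edge `Im z = -π`, which is reached from `Im z = π` by one
period. -/
theorem order_nonneg_of_fundamental {f : ℂ → ℂ}
    (hper : ∀ z, f (z + 2 * Real.pi * Complex.I) = f z) {z : ℂ}
    (h : ∀ y : ℂ, y.re = z.re → -Real.pi < y.im → y.im ≤ Real.pi → 0 ≤ meromorphicOrderAt f y)
    (h1 : -Real.pi ≤ z.im) (h2 : z.im ≤ Real.pi) : 0 ≤ meromorphicOrderAt f z := by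
  rcases h1.eq_or_lt with h1 | h1
  · rw [← meromorphicOrderAt_add_period hper z]
    refine h _ (by simp) ?_ ?_
    · simp [← h1]; linarith [Real.pi_pos]
    · simp [← h1]; linarith [Real.pi_pos]
  · exact h z rfl h1 h2

theorem integral_vertical_eq_of_periodic {f : ℂ → ℂ} (hf : Meromorphic f)
    (hper : ∀ z, f (z + 2 * Real.pi * Complex.I) = f z) {a b : ℝ} (hab : a ≤ b)
    (h : ∀ z : ℂ, a ≤ z.re → z.re ≤ b → -Real.pi < z.im → z.im ≤ Real.pi →
      0 ≤ meromorphicOrderAt f z) :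
    ∫ θ in (-Real.pi)..Real.pi, f (b + θ * Complex.I) =
      ∫ θ in (-Real.pi)..Real.pi, f (a + θ * Complex.I) := by
  have hR := integral_boundary_rect_eq_zero_of_meromorphic hf hab
    (by linarith [Real.pi_pos] : -Real.pi ≤ Real.pi) fun z h1 h2 h3 h4 =>
      order_nonneg_of_fundamental hper (fun y hy h5 h6 => h y (hy ▸ h1) (hy ▸ h2) h5 h6) h3 h4
  have hh : ∫ x : ℝ in a..b, f (x + (Real.pi : ℝ) * Complex.I) =
      ∫ x : ℝ in a..b, f (x + ((-Real.pi : ℝ) : ℂ) * Complex.I) := by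
    refine intervalIntegral.integral_congr fun x _ => ?_
    rw [← hper ((x : ℂ) + ((-Real.pi : ℝ) : ℂ) * Complex.I)]
    congr 1
    push_cast
    ring
  rw [hh, sub_self, zero_add, sub_eq_zero] at hR
  exact mul_left_cancel₀ Complex.I_ne_zero hR

/-- Poles may lie on the edge `Im z = π`, so a contour around the period rectangle is unsuitable.
Instead the periodic principal part at one pole is subtracted at a time. Its line integrals jump by
`2π` times the residue, and once no pole is left the two line integrals agree. -/
theorem integral_vertical_sub_eq_sum_residue (S : Finset ℂ) {a b : ℝ} (hab : a ≤ b) :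
    ∀ f : ℂ → ℂ, Meromorphic f → (∀ z, f (z + 2 * Real.pi * Complex.I) = f z) →
    (∀ w ∈ S, a < w.re ∧ w.re < b ∧ -Real.pi < w.im ∧ w.im ≤ Real.pi) →
    (∀ z : ℂ, a ≤ z.re → z.re ≤ b → -Real.pi < z.im → z.im ≤ Real.pi → z ∉ S →
      0 ≤ meromorphicOrderAt f z) →
    (∫ θ in (-Real.pi)..Real.pi, f (b + θ * Complex.I)) -
      (∫ θ in (-Real.pi)..Real.pi, f (a + θ * Complex.I)) =
        2 * Real.pi * ∑ w ∈ S, residue f w := by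
  classical
  induction S using Finset.induction_on with
  | empty =>
    intro f hf hper _ h
    rw [integral_vertical_eq_of_periodic hf hper hab fun z h1 h2 h3 h4 =>
      h z h1 h2 h3 h4 (Finset.notMem_empty z)]
    simp
  | insert w S hwS ih =>
    intro f hf hper hS h
    obtain ⟨hw1, hw2, hw3, hw4⟩ := hS w (Finset.mem_insert_self w S)
    obtain ⟨N, g, hg, hfg⟩ := (hf w).exists_eq_div_pow
    obtain ⟨α, ψ, hψ, hα⟩ := exists_principalPart (periodicPole w) (periodicPoleFactor w)
      (periodicPoleFactor_analyticAt w) (periodicPoleFactor_self_ne_zero w)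
      (periodicPole_eq_div w) N f g hg hfg
    set p : ℂ → ℂ := fun z => ∑ n ∈ Finset.range N, α n * periodicPole w n z with hp
    -- `exp` is injective on the fundamental domain, so `p` is analytic at its other points and
    -- disturbs neither their residues nor their orders.
    have hexp : ∀ z : ℂ, -Real.pi < z.im → z.im ≤ Real.pi → z ≠ w →
        Complex.exp z ≠ Complex.exp w := fun z h1 h2 hne he =>
      hne (Complex.exp_inj_of_neg_pi_lt_of_le_pi h1 h2 hw3 hw4 he)
    have hpan : ∀ z, Complex.exp z ≠ Complex.exp w → AnalyticAt ℂ p z := fun z hz =>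
      Finset.analyticAt_fun_sum _ fun n _ => analyticAt_const.mul (periodicPole_analyticAt n hz)
    have hpm : Meromorphic p := fun z => MeromorphicAt.fun_sum fun n _ =>
      (analyticAt_const.meromorphicAt).mul (periodicPole_meromorphic w n z)
    have hpper : ∀ z, p (z + 2 * Real.pi * Complex.I) = p z := fun z => by
      simp only [hp, periodicPole_periodic]
    have hresp : HasResidue p w (∑ n ∈ Finset.range N, α n * if n = 0 then 1 else 0) :=
      HasResidue.sum _ fun n _ => (hasResidue_periodicPole w n).const_mul (α n)
    have hresf : residue f w = ∑ n ∈ Finset.range N, α n * if n = 0 then 1 else 0 := by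
      have := hresp.add (HasResidue.of_analyticAt hψ)
      rw [add_zero] at this
      refine (this.congr ?_).residue_eq
      filter_upwards [hα] with z hz
      rw [← hz]
      ring
    have hresS : ∀ v ∈ S, residue (fun z => f z - p z) v = residue f v := by
      intro v hv
      obtain ⟨-, -, hv3, hv4⟩ := hS v (Finset.mem_insert_of_mem hv)
      have := (HasResidue.of_meromorphicAt (hf v)).sub (HasResidue.of_analyticAt
        (hpan v (hexp v hv3 hv4 (by rintro rfl; exact hwS hv))))
      rw [sub_zero] at this
      exact this.residue_eq
    have hadd : ∀ z, 0 ≤ meromorphicOrderAt f z → Complex.exp z ≠ Complex.exp w →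
        0 ≤ meromorphicOrderAt (fun z => f z - p z) z := by
      intro z hz hne
      have h1 := meromorphicOrderAt_add (hf z) (hpan z hne).neg.meromorphicAt
      have h2 : (f + -p) = fun z => f z - p z := by
        ext y; simp [sub_eq_add_neg]
      rw [h2] at h1
      exact (le_min hz (hpan z hne).neg.meromorphicOrderAt_nonneg).trans h1
    have key := ih (fun z => f z - p z) (fun z => (hf z).sub (hpm z))
      (fun z => by rw [hper, hpper])
      (fun v hv => hS v (Finset.mem_insert_of_mem hv)) (by
        intro z h1 h2 h3 h4 hz
        by_cases hzw : z = w
        · subst hzw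
          rw [meromorphicOrderAt_congr hα]
          exact hψ.meromorphicOrderAt_nonneg
        · exact hadd z (h z h1 h2 h3 h4 (by simp [hzw, hz])) (hexp z h3 h4 hzw))
    have hint : ∀ r : ℝ, a ≤ r → r ≤ b → (∀ v ∈ insert w S, r ≠ v.re) →
        IntervalIntegrable (fun θ : ℝ => f (r + θ * Complex.I)) volume (-Real.pi) Real.pi := by
      intro r h1 h2 h3
      refine intervalIntegrable_vertical hf fun θ hθ => ?_
      rw [uIcc_of_le (by linarith [Real.pi_pos])] at hθ
      refine order_nonneg_of_fundamental hper (fun y hy h5 h6 => ?_) (by simpa using hθ.1)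
        (by simpa using hθ.2)
      have hyr : y.re = r := by simpa using hy
      refine h y (hyr ▸ h1) (hyr ▸ h2) h5 h6 fun hmem => h3 y hmem hyr.symm
    have hpint : ∀ r : ℝ, r ≠ w.re → ∀ n, IntervalIntegrable
        (fun θ : ℝ => α n * periodicPole w n (r + θ * Complex.I)) volume (-Real.pi) Real.pi := by
      intro r hr n
      refine ContinuousOn.intervalIntegrable fun θ _ => ?_
      exact (continuousAt_const.mul (ContinuousAt.comp (f := fun y : ℝ => (r : ℂ) + y * Complex.I)
        (periodicPole_analyticAt n (cexp_vertical_ne hr θ)).continuousAt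
        (by fun_prop))).continuousWithinAt
    have hsplit : ∀ r : ℝ, a ≤ r → r ≤ b → (∀ v ∈ insert w S, r ≠ v.re) →
        ∫ θ in (-Real.pi)..Real.pi, (f (r + θ * Complex.I) - p (r + θ * Complex.I)) =
          (∫ θ in (-Real.pi)..Real.pi, f (r + θ * Complex.I)) - ∑ n ∈ Finset.range N,
            α n * ∫ θ in (-Real.pi)..Real.pi, periodicPole w n (r + θ * Complex.I) := by
      intro r h1 h2 h3
      have hr := h3 w (Finset.mem_insert_self w S)
      rw [intervalIntegral.integral_sub (hint r h1 h2 h3)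
        (by simpa [hp, Finset.sum_fn] using
          IntervalIntegrable.sum (Finset.range N) fun n _ => hpint r hr n)]
      simp only [hp]
      rw [intervalIntegral.integral_finsetSum fun n _ => hpint r hr n]
      simp only [intervalIntegral.integral_const_mul]
    rw [hsplit b hab le_rfl fun v hv => (hS v hv).2.1.ne',
      hsplit a le_rfl hab fun v hv => (hS v hv).1.ne, Finset.sum_congr rfl hresS] at key
    rw [Finset.sum_insert hwS, hresf, mul_add, ← key, Finset.mul_sum]
    have hb : ∀ n, α n * ∫ θ in (-Real.pi)..Real.pi, periodicPole w n (b + θ * Complex.I) =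
        2 * Real.pi * (α n * if n = 0 then 1 else 0) := by
      intro n
      split_ifs with hn
      · rw [hn, integral_periodicPole_of_gt hw2]; ring
      · rw [integral_periodicPole_of_ne_zero hn hw2.ne']; ring
    have ha : ∀ n, α n * ∫ θ in (-Real.pi)..Real.pi, periodicPole w n (a + θ * Complex.I) = 0 := by
      intro n
      by_cases hn : n = 0
      · rw [hn, integral_periodicPole_of_lt hw1, mul_zero]
      · rw [integral_periodicPole_of_ne_zero hn hw1.ne, mul_zero]
    simp only [ha, hb, Finset.sum_const_zero]
    ring

/-- The Laplace transform `∫ e^{zx} dF(x)`. -/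
noncomputable def laplace (F : Measure ℝ) (z : ℂ) : ℂ := ∫ x : ℝ, Complex.exp (z * (x : ℂ)) ∂F

/-! ### Convolution powers, the renewal measure and their Laplace transforms -/

section Convolution

variable {F : Measure ℝ} [IsProbabilityMeasure F]

instance isProbabilityMeasure_convPow (n : ℕ) : IsProbabilityMeasure (convPow F n) := by
  induction n with
  | zero => exact Measure.dirac.isProbabilityMeasure
  | succ n ih =>
    have := ih
    exact Measure.probabilitymeasure_of_probabilitymeasures_conv (convPow F n) F

/-- A sum of points of an additive submonoid stays in it. The submonoids needed are `[0, ∞)` and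
`ℕ`. -/
theorem convPow_compl_eq_zero {S : Set ℝ} (hS : MeasurableSet S) (h0 : (0 : ℝ) ∈ S)
    (hadd : ∀ x ∈ S, ∀ y ∈ S, x + y ∈ S) (hF : F Sᶜ = 0) (n : ℕ) : convPow F n Sᶜ = 0 := by
  induction n with
  | zero => simp [convPow, hS, h0]
  | succ n ih =>
    have h1 : ∀ᵐ x ∂convPow F n, x ∈ S := ih
    have h2 : ∀ᵐ y ∂F, y ∈ S := hF
    have h3 : ∀ᵐ x ∂convPow F (n + 1), x ∈ S := by
      rw [convPow, Measure.conv, ae_map_iff (p := fun x => x ∈ S) (by fun_prop) hS]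
      rw [Measure.ae_prod_iff_ae_ae (hS.preimage (by fun_prop))]
      filter_upwards [h1] with x hx
      filter_upwards [h2] with y hy
      exact hadd x hx y hy
    exact h3

theorem ae_convPow_nonneg (hF : F (Iio 0) = 0) (n : ℕ) : ∀ᵐ x ∂convPow F n, 0 ≤ x := by
  have h := convPow_compl_eq_zero (F := F) (S := Ici 0) measurableSet_Ici (by simp)
    (fun x hx y hy => mem_Ici.2 (add_nonneg hx hy)) (by simpa using hF) n
  exact h

theorem integrable_cexp_mul {μ : Measure ℝ} [IsFiniteMeasure μ] (hμ : ∀ᵐ x ∂μ, 0 ≤ x) {z : ℂ}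
    (hz : z.re ≤ 0) : Integrable (fun x : ℝ => Complex.exp (z * x)) μ := by
  refine Integrable.of_bound (by fun_prop) 1 ?_
  filter_upwards [hμ] with x hx
  rw [Complex.norm_exp]
  simpa using mul_nonpos_of_nonpos_of_nonneg hz hx

theorem laplace_convPow (hF : F (Iio 0) = 0) {z : ℂ} (hz : z.re ≤ 0) (n : ℕ) :
    laplace (convPow F n) z = laplace F z ^ n := by
  induction n with
  | zero => simp [laplace, convPow]
  | succ n ih =>
    have hint := integrable_cexp_mul (ae_convPow_nonneg hF (n + 1)) hz
    rw [laplace, convPow] at *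
    rw [integral_conv (by simpa [convPow] using hint)]
    simp only [Complex.ofReal_add, mul_add, Complex.exp_add, integral_const_mul,
      integral_mul_const]
    rw [pow_succ, ← ih, laplace]

theorem integrable_exp_neg_mul {μ : Measure ℝ} [IsFiniteMeasure μ] (hμ : ∀ᵐ x ∂μ, 0 ≤ x) {a : ℝ}
    (ha : 0 ≤ a) : Integrable (fun x : ℝ => Real.exp (-a * x)) μ := by
  refine Integrable.of_bound (by fun_prop) 1 ?_
  filter_upwards [hμ] with x hx
  rw [Real.norm_eq_abs, Real.abs_exp, Real.exp_le_one_iff]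
  nlinarith

theorem ae_nonneg_of_Iio {F : Measure ℝ} (hF : F (Iio 0) = 0) : ∀ᵐ x ∂F, 0 ≤ x := by
  have : F (Ici 0)ᶜ = 0 := by simpa using hF
  exact this

theorem norm_laplace_le {F : Measure ℝ} (z : ℂ) :
    ‖laplace F z‖ ≤ ∫ x : ℝ, Real.exp (z.re * x) ∂F := by
  refine (norm_integral_le_integral_norm _).trans_eq ?_
  refine integral_congr_ae (Eventually.of_forall fun x => ?_)
  simp [Complex.norm_exp]

theorem laplace_ofReal (F : Measure ℝ) (a : ℝ) :
    laplace F a = ((∫ x : ℝ, Real.exp (a * x) ∂F : ℝ) : ℂ) := by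
  refine Eq.trans (integral_congr_ae (Eventually.of_forall fun x => ?_)) integral_ofReal
  simp

/-- Strictness comes from the mass off `0`. It makes the geometric series converge and excludes the
unit mass at `0`, whose renewal measure is infinite at `0`. -/
theorem integral_exp_lt_one (hF : F (Iio 0) = 0) (h0 : F {0}ᶜ ≠ 0) {a : ℝ} (ha : 0 < a) :
    ∫ x : ℝ, Real.exp (-a * x) ∂F < 1 := by
  have hint := integrable_exp_neg_mul (ae_nonneg_of_Iio hF) ha.le
  have hpos : 0 < ∫ x : ℝ, (1 - Real.exp (-a * x)) ∂F := by
    rw [integral_pos_iff_support_of_nonneg_ae]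
    · refine lt_of_lt_of_le (pos_iff_ne_zero.2 h0) (measure_mono fun x hx => ?_)
      have hx' : x ≠ 0 := hx
      rw [Function.mem_support, sub_ne_zero, ne_comm, Ne, Real.exp_eq_one_iff]
      exact mul_ne_zero (neg_ne_zero.2 ha.ne') hx'
    · filter_upwards [ae_nonneg_of_Iio hF] with x hx
      simp only [Pi.zero_apply, sub_nonneg, Real.exp_le_one_iff]
      nlinarith
    · exact (integrable_const 1).sub hint
  rw [integral_sub (integrable_const 1) hint] at hpos
  simpa using hpos

theorem integral_exp_convPow (hF : F (Iio 0) = 0) {a : ℝ} (ha : 0 ≤ a) (n : ℕ) :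
    ∫ x : ℝ, Real.exp (-a * x) ∂convPow F n = (∫ x : ℝ, Real.exp (-a * x) ∂F) ^ n := by
  have h := laplace_convPow hF (z := ((-a : ℝ) : ℂ)) (by simpa using ha) n
  rw [laplace_ofReal, laplace_ofReal] at h
  exact_mod_cast h

instance sFinite_renewalMeasure : SFinite (renewalMeasure F) := by
  unfold renewalMeasure; infer_instance

theorem renewalMeasure_compl_eq_zero {S : Set ℝ} (hS : MeasurableSet S) (h0 : (0 : ℝ) ∈ S)
    (hadd : ∀ x ∈ S, ∀ y ∈ S, x + y ∈ S) (hF : F Sᶜ = 0) : renewalMeasure F Sᶜ = 0 := by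
  rw [renewalMeasure, Measure.sum_apply _ hS.compl]
  simp [convPow_compl_eq_zero hS h0 hadd hF]

theorem ae_renewalMeasure_nonneg (hF : F (Iio 0) = 0) : ∀ᵐ x ∂renewalMeasure F, 0 ≤ x := by
  have h := renewalMeasure_compl_eq_zero (F := F) (S := Ici 0) measurableSet_Ici (by simp)
    (fun x hx y hy => mem_Ici.2 (add_nonneg hx hy)) (by simpa using hF)
  exact h

theorem integrable_exp_renewalMeasure (hF : F (Iio 0) = 0) (h0 : F {0}ᶜ ≠ 0) {a : ℝ}
    (ha : 0 < a) : Integrable (fun x : ℝ => Real.exp (-a * x)) (renewalMeasure F) := by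
  refine integrable_sum_measure
    (fun n => integrable_exp_neg_mul (ae_convPow_nonneg hF n) ha.le) ?_
  simp only [Real.norm_eq_abs, Real.abs_exp, integral_exp_convPow hF ha.le]
  exact summable_geometric_of_lt_one (integral_nonneg fun x => (Real.exp_pos _).le)
    (integral_exp_lt_one hF h0 ha)

theorem integrable_cexp_renewalMeasure (hF : F (Iio 0) = 0) (h0 : F {0}ᶜ ≠ 0) {z : ℂ}
    (hz : z.re < 0) : Integrable (fun x : ℝ => Complex.exp (z * x)) (renewalMeasure F) := by
  refine (integrable_exp_renewalMeasure hF h0 (neg_pos.2 hz)).mono' (by fun_prop) ?_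
  refine Eventually.of_forall fun x => ?_
  rw [Complex.norm_exp]
  simp

theorem norm_laplace_lt_one (hF : F (Iio 0) = 0) (h0 : F {0}ᶜ ≠ 0) {z : ℂ} (hz : z.re < 0) :
    ‖laplace F z‖ < 1 := by
  refine (norm_laplace_le z).trans_lt ?_
  simpa using integral_exp_lt_one hF h0 (neg_pos.2 hz)

theorem laplace_renewalMeasure (hF : F (Iio 0) = 0) (h0 : F {0}ᶜ ≠ 0) {z : ℂ} (hz : z.re < 0) :
    laplace (renewalMeasure F) z = 1 / (1 - laplace F z) := by
  have h := hasSum_integral_measure (integrable_cexp_renewalMeasure hF h0 hz)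
  have h2 := hasSum_geometric_of_norm_lt_one (norm_laplace_lt_one hF h0 hz)
  rw [one_div]
  refine HasSum.unique (f := fun n => laplace F z ^ n) ?_ h2
  simp only [← laplace_convPow hF hz.le]
  exact h

/-- Markov's inequality: `e^{-x} ≥ e^{-c}` on `(-∞, c]`. -/
theorem renewalMeasure_Iic_lt_top (hF : F (Iio 0) = 0) (h0 : F {0}ᶜ ≠ 0) (c : ℝ) :
    renewalMeasure F (Iic c) < ⊤ := by
  have h := (integrable_exp_renewalMeasure hF h0 one_pos).measure_ge_lt_top
    (ε := Real.exp (-c)) (Real.exp_pos _)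
  refine lt_of_le_of_lt (measure_mono fun x hx => ?_) h
  have hx' : x ≤ c := hx
  simpa using hx'

end Convolution

/-! ### The meromorphic extension -/

namespace IsMeromorphicExtension

variable {F : Measure ℝ} {G : ℂ → ℂ}

theorem meromorphic' (hG : IsMeromorphicExtension F G) : Meromorphic G := fun z =>
  (hG.meromorphic (mem_univ z)).meromorphicAt

theorem one_sub (hG : IsMeromorphicExtension F G) : Meromorphic fun z => 1 - G z := fun z =>
  (analyticAt_const.meromorphicAt).sub (hG.meromorphic' z)

theorem eq_laplace (hG : IsMeromorphicExtension F G) (hR : 0 < expRadius F) {z : ℂ}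
    (hz : z.re ≤ 0) : G z = laplace F z := by
  refine hG.eq_mgf z (lt_of_le_of_lt ?_ hR)
  exact_mod_cast hz

/-- A function in normal form with a nonzero value at a point has order `0` there. -/
theorem analyticAt_of_eq_one (hG : IsMeromorphicExtension F G) {w : ℂ} (hw : G w = 1) :
    AnalyticAt ℂ G w := by
  have h := hG.meromorphic (mem_univ w)
  rw [← h.meromorphicOrderAt_nonneg_iff_analyticAt]
  exact (h.meromorphicOrderAt_eq_zero_iff.2 (by simp [hw])).ge

/-- Besides the points of analyticity this covers the poles of `G`: there `1 - G` has negative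
order, so the quotient has no pole. -/
theorem order_div_nonneg (hG : IsMeromorphicExtension F G) {h : ℂ → ℂ} {z : ℂ}
    (hh : AnalyticAt ℂ h z) (hz : G z ≠ 1) :
    0 ≤ meromorphicOrderAt (fun z => h z / (1 - G z)) z := by
  have hNF := hG.meromorphic (mem_univ z)
  by_cases ho : 0 ≤ meromorphicOrderAt G z
  · have hGa := hNF.meromorphicOrderAt_nonneg_iff_analyticAt.1 ho
    exact (hh.div (analyticAt_const.sub hGa)
      (sub_ne_zero.2 (Ne.symm hz))).meromorphicOrderAt_nonneg
  · push Not at ho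
    have h1 : meromorphicOrderAt (fun z => 1 - G z) z < 0 := by
      have h2 : meromorphicOrderAt (-G + fun _ => (1 : ℂ)) z = meromorphicOrderAt (-G) z := by
        refine meromorphicOrderAt_add_eq_left_of_lt analyticAt_const.meromorphicAt ?_
        rw [← meromorphicOrderAt_neg]
        exact ho.trans_le (analyticAt_const (𝕜 := ℂ) (v := (1 : ℂ))).meromorphicOrderAt_nonneg
      have h3 : (-G + fun _ => (1 : ℂ)) = fun z => 1 - G z := by ext y; simp; ring
      rw [h3] at h2
      rwa [h2, ← meromorphicOrderAt_neg]
    have h4 : (fun z => h z / (1 - G z)) = h * (fun z => 1 - G z)⁻¹ := by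
      ext y; simp [div_eq_mul_inv]
    rw [h4, meromorphicOrderAt_mul hh.meromorphicAt (hG.one_sub z).inv, meromorphicOrderAt_inv]
    refine add_nonneg hh.meromorphicOrderAt_nonneg ?_
    generalize meromorphicOrderAt (fun z => 1 - G z) z = o at h1
    cases o with
    | top => simp at h1
    | coe n =>
      have h5 : n < 0 := by exact_mod_cast h1
      have h6 : (0 : ℤ) ≤ -n := by omega
      have : (0 : WithTop ℤ) ≤ ((-n : ℤ) : WithTop ℤ) := by exact_mod_cast h6
      exact this

theorem meromorphic_div (hG : IsMeromorphicExtension F G) {h : ℂ → ℂ}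
    (hh : ∀ z, AnalyticAt ℂ h z) : Meromorphic fun z => h z / (1 - G z) := fun z =>
  (hh z).meromorphicAt.div (hG.one_sub z)

/-- By the identity theorem it is enough that `1 - G` does not vanish near `-1`, where `|G| < 1`. -/
theorem order_one_sub_ne_top [IsProbabilityMeasure F] (hF : F (Iio 0) = 0) (h0 : F {0}ᶜ ≠ 0)
    (hR : 0 < expRadius F) (hG : IsMeromorphicExtension F G) (z : ℂ) :
    meromorphicOrderAt (fun z => 1 - G z) z ≠ ⊤ := by
  refine (hG.one_sub.meromorphicOn (s := univ)).meromorphicOrderAt_ne_top_of_isPreconnected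
    (x := -1) isPreconnected_univ (mem_univ _) (mem_univ _) ?_
  rw [meromorphicOrderAt_ne_top_iff_eventually_ne_zero (hG.one_sub _)]
  refine eventually_nhdsWithin_of_eventually_nhds ?_
  have : {z : ℂ | z.re < 0} ∈ 𝓝 (-1 : ℂ) :=
    (isOpen_lt Complex.continuous_re continuous_const).mem_nhds (by simp)
  filter_upwards [this] with y hy
  rw [hG.eq_laplace hR (le_of_lt hy), sub_ne_zero]
  intro h
  have := norm_laplace_lt_one hF h0 hy
  rw [← h] at this
  simp at this

theorem eventually_ne_one [IsProbabilityMeasure F] (hF : F (Iio 0) = 0) (h0 : F {0}ᶜ ≠ 0)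
    (hR : 0 < expRadius F) (hG : IsMeromorphicExtension F G) (w : ℂ) :
    ∀ᶠ z in 𝓝[≠] w, G z ≠ 1 := by
  have := (meromorphicOrderAt_ne_top_iff_eventually_ne_zero (hG.one_sub w)).1
    (order_one_sub_ne_top hF h0 hR hG w)
  filter_upwards [this] with z hz h
  exact hz (by rw [h, sub_self])

theorem re_nonneg_of_eq_one [IsProbabilityMeasure F] (hF : F (Iio 0) = 0) (h0 : F {0}ᶜ ≠ 0)
    (hR : 0 < expRadius F) (hG : IsMeromorphicExtension F G) {w : ℂ} (hw : G w = 1) :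
    0 ≤ w.re := by
  by_contra h
  push Not at h
  have h1 := norm_laplace_lt_one hF h0 h
  rw [← hG.eq_laplace hR h.le, hw] at h1
  simp at h1

/-- The roots are isolated and have `Re z ≥ 0`, so those in question lie in a compact rectangle
without accumulation point. -/
theorem finite_roots_inter [IsProbabilityMeasure F] (hF : F (Iio 0) = 0) (h0 : F {0}ᶜ ≠ 0)
    (hR : 0 < expRadius F) (hG : IsMeromorphicExtension F G) (ρ T : ℝ) :
    {z : ℂ | G z = 1 ∧ z.re ≤ ρ ∧ |z.im| ≤ T}.Finite := by
  by_contra hinf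
  have hK : IsCompact (Icc 0 ρ ×ℂ Icc (-T) T) := isCompact_Icc.reProdIm isCompact_Icc
  obtain ⟨w, -, hw⟩ := Set.Infinite.exists_accPt_of_subset_isCompact hinf hK (by
    rintro z ⟨h1, h2, h3⟩
    exact ⟨⟨re_nonneg_of_eq_one hF h0 hR hG h1, h2⟩, abs_le.1 h3⟩)
  rw [accPt_iff_frequently_nhdsNE] at hw
  exact hw ((eventually_ne_one hF h0 hR hG w).mono fun z hz h => hz h.1)

/-- At a root, `1 - G z = -(z - w) * dslope G w z` with `dslope G w w = deriv G w ≠ 0`, which is a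
simple zero. -/
theorem hasResidue_div (hG : IsMeromorphicExtension F G) {h : ℂ → ℂ} {w : ℂ}
    (hh : AnalyticAt ℂ h w) (hw : G w = 1) (hd : deriv G w ≠ 0) :
    ∃ ψ, AnalyticAt ℂ ψ w ∧ ∀ᶠ z in 𝓝[≠] w,
      h z / (1 - G z) = -(h w / deriv G w) * (z - w)⁻¹ + ψ z := by
  have hGa := hG.analyticAt_of_eq_one hw
  set k : ℂ → ℂ := fun z => -(h z / dslope G w z) with hk
  have hka : AnalyticAt ℂ k w := (hh.div hGa.dslope (by rwa [dslope_same])).neg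
  refine ⟨dslope k w, hka.dslope, ?_⟩
  have hne : ∀ᶠ z in 𝓝[≠] w, dslope G w z ≠ 0 :=
    eventually_nhdsWithin_of_eventually_nhds
      (hGa.dslope.continuousAt.eventually_ne (by rwa [dslope_same]))
  filter_upwards [hne, self_mem_nhdsWithin] with z hz1 hz2
  have hz' : z - w ≠ 0 := sub_ne_zero.2 hz2
  have hkw : k w = -(h w / deriv G w) := by simp only [hk, dslope_same]
  have hGz : 1 - G z = -((z - w) * dslope G w z) := by
    rw [dslope_of_ne _ hz2, slope_def_field, mul_div_cancel₀ _ hz', hw]; ring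
  rw [← hkw, dslope_of_ne k hz2, slope_def_field, hGz]
  have : k z = -(h z / dslope G w z) := rfl
  rw [this]
  field_simp
  ring

theorem residue_div (hG : IsMeromorphicExtension F G) {h : ℂ → ℂ} {w : ℂ}
    (hh : AnalyticAt ℂ h w) (hw : G w = 1) (hd : deriv G w ≠ 0) :
    residue (fun z => h z / (1 - G z)) w = -(h w / deriv G w) := by
  obtain ⟨ψ, hψ, h1⟩ := hG.hasResidue_div hh hw hd
  have := ((HasResidue.sub_inv w).const_mul (-(h w / deriv G w))).add (HasResidue.of_analyticAt hψ)
  rw [mul_one, add_zero] at this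
  exact (this.congr (h1.mono fun z hz => hz.symm)).residue_eq

end IsMeromorphicExtension

/-! ### Good abscissae, the identity theorem and ordered root sums -/

theorem exists_seq_of_liminf_eq_zero {f : ℝ → ℝ≥0∞} (h : liminf f atTop = 0) :
    ∃ r : ℕ → ℝ, Tendsto r atTop atTop ∧ Tendsto (fun n => f (r n)) atTop (𝓝 0) := by
  have key : ∀ n : ℕ, ∃ r : ℝ, (n : ℝ) ≤ r ∧ f r < ((n : ℝ≥0∞) + 1)⁻¹ := by
    intro n
    have hpos : (0 : ℝ≥0∞) < ((n : ℝ≥0∞) + 1)⁻¹ := by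
      rw [ENNReal.inv_pos]
      exact ENNReal.add_ne_top.2 ⟨ENNReal.natCast_ne_top n, ENNReal.one_ne_top⟩
    have hf := frequently_lt_of_liminf_lt (h := h.trans_lt hpos)
    obtain ⟨r, hr1, hr2⟩ := (hf.and_eventually (eventually_ge_atTop (n : ℝ))).exists
    exact ⟨r, hr2, hr1⟩
  choose r hr1 hr2 using key
  refine ⟨r, tendsto_atTop_mono hr1 tendsto_natCast_atTop_atTop, ?_⟩
  have hlim : Tendsto (fun n : ℕ => ((n : ℝ≥0∞) + 1)⁻¹) atTop (𝓝 0) := by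
    have h1 := ENNReal.tendsto_inv_nat_nhds_zero.comp (tendsto_add_atTop_nat 1)
    refine h1.congr fun n => ?_
    simp
  exact tendsto_of_tendsto_of_tendsto_of_le_of_le tendsto_const_nhds hlim (fun _ => zero_le)
    fun n => (hr2 n).le

/-- Identity theorem; the normal form upgrades agreement near each point to agreement at the point,
poles included. -/
theorem eq_of_eq_left_halfPlane {f g : ℂ → ℂ} (hf : MeromorphicNFOn f univ)
    (hg : MeromorphicNFOn g univ) (h : ∀ z : ℂ, z.re < 0 → f z = g z) : f = g := by
  have hm : MeromorphicOn (f - g) univ := hf.meromorphicOn.sub hg.meromorphicOn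
  have h1 : meromorphicOrderAt (f - g) (-1) = ⊤ := by
    rw [meromorphicOrderAt_eq_top_iff]
    refine eventually_nhdsWithin_of_eventually_nhds ?_
    have : {z : ℂ | z.re < 0} ∈ 𝓝 (-1 : ℂ) :=
      (isOpen_lt Complex.continuous_re continuous_const).mem_nhds (by simp)
    filter_upwards [this] with y hy
    simp [h y hy]
  ext z
  have h2 : meromorphicOrderAt (f - g) z = ⊤ := by
    by_contra hne
    exact hm.meromorphicOrderAt_ne_top_of_isPreconnected isPreconnected_univ (mem_univ z)
      (mem_univ (-1)) hne h1
  rw [meromorphicOrderAt_eq_top_iff] at h2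
  have h3 : f =ᶠ[𝓝[≠] z] g := h2.mono fun y hy => sub_eq_zero.1 hy
  exact (((hf (mem_univ z)).eventuallyEq_nhdsNE_iff_eventuallyEq_nhds (hg (mem_univ z))).1
    h3).eq_of_nhds

/-- Convergence along good abscissae implies the last two clauses. Finitely many roots are
eventually all included. For an enumeration by nondecreasing real part the roots left of `r n` are
an initial segment, so the half-plane sums are taken from the partial sums of the series. -/
theorem isOrderedRootSum_of_tendsto {G : ℂ → ℂ} {m : ℕ} {a : ℂ → ℂ} {s : ℂ}
    (hfin : ∀ ρ : ℝ, {z | z ∈ stripRoots G ∧ z.re < ρ}.Finite)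
    (hex : ∃ r : ℕ → ℝ, Tendsto r atTop atTop ∧
      Tendsto (fun n => latticeSup G m (r n)) atTop (𝓝 0))
    (ht : ∀ r : ℕ → ℝ, Tendsto r atTop atTop →
      Tendsto (fun n => latticeSup G m (r n)) atTop (𝓝 0) →
      Tendsto (fun n => ∑ᶠ z ∈ {z | z ∈ stripRoots G ∧ z.re < r n}, a z) atTop (𝓝 s)) :
    IsOrderedRootSum G m a s where
  finite_halfPlane := hfin
  exists_abscissae := hex
  tendsto_of_abscissae := ht
  eq_of_finite hf := by
    obtain ⟨r, hr, hl⟩ := hex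
    refine tendsto_nhds_unique (ht r hr hl) (tendsto_const_nhds.congr' ?_)
    have hev : ∀ᶠ n in atTop, ∀ z ∈ stripRoots G, z.re < r n := by
      rw [Filter.eventually_all_finite hf]
      exact fun z _ => hr.eventually_gt_atTop z.re
    filter_upwards [hev] with n hn
    have : {z | z ∈ stripRoots G ∧ z.re < r n} = stripRoots G :=
      Set.ext fun z => ⟨fun h => h.1, fun h => ⟨h, hn z h⟩⟩
    exact finsum_mem_congr this.symm fun _ _ => rfl
  eq_of_tendsto z t hinj hrange hmono hz := by
    obtain ⟨r, hr, hl⟩ := hex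
    -- `N` is the first index whose real part reaches `r n`; one exists because only finitely many
    -- roots lie to the left.
    have hN : ∀ n, ∃ N : ℕ, ∀ j, (z j).re < r n ↔ j < N := by
      intro n
      have hfin' : {j | (z j).re < r n}.Finite := by
        refine Set.Finite.of_finite_image (f := z) ((hfin (r n)).subset ?_) hinj.injOn
        rintro _ ⟨j, hj, rfl⟩
        exact ⟨hrange ▸ mem_range_self j, hj⟩
      have hex : ∃ N, ¬ (z N).re < r n := by
        by_contra hall
        push Not at hall
        have : {j | (z j).re < r n} = univ := Set.eq_univ_of_forall hall
        rw [this] at hfin'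
        exact Set.infinite_univ hfin'
      classical
      refine ⟨Nat.find hex, fun j => ⟨fun hj => ?_, fun hj => not_not.1 (Nat.find_min hex hj)⟩⟩
      by_contra hle
      exact Nat.find_spec hex ((hmono (not_lt.1 hle)).trans_lt hj)
    choose N hN using hN
    have hNt : Tendsto N atTop atTop := by
      rw [tendsto_atTop]
      intro b
      filter_upwards [hr.eventually_gt_atTop (z b).re] with n hn
      exact ((hN n b).1 hn).le
    refine tendsto_nhds_unique (hz.comp hNt) ((ht r hr hl).congr fun n => ?_)
    have himg : {w | w ∈ stripRoots G ∧ w.re < r n} = z '' (Finset.range (N n) : Set ℕ) := by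
      ext w
      rw [← hrange]
      constructor
      · rintro ⟨⟨j, rfl⟩, hj⟩
        exact ⟨j, by simpa using (hN n j).1 hj, rfl⟩
      · rintro ⟨j, hj, rfl⟩
        exact ⟨mem_range_self j, (hN n j).2 (by simpa using hj)⟩
    rw [himg, finsum_mem_image hinj.injOn, finsum_mem_coe_finset]
    rfl

theorem IsOrderedRootSum.congr {G : ℂ → ℂ} {m : ℕ} {a b : ℂ → ℂ} {s : ℂ}
    (h : IsOrderedRootSum G m a s) (hab : ∀ w ∈ stripRoots G, a w = b w) :
    IsOrderedRootSum G m b s := by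
  refine isOrderedRootSum_of_tendsto h.finite_halfPlane h.exists_abscissae fun r hr hl =>
    (h.tendsto_of_abscissae r hr hl).congr fun n => finsum_mem_congr rfl fun w hw => hab w hw.1

theorem inv_enorm_le_ofReal {w : ℂ} {ε : ℝ} (h : ‖w‖ₑ⁻¹ ≤ ENNReal.ofReal ε) :
    w ≠ 0 ∧ ‖w‖⁻¹ ≤ ε := by
  have hw : w ≠ 0 := by
    rintro rfl
    simp at h
  refine ⟨hw, ?_⟩
  rw [← enorm_inv hw, ← ofReal_norm, norm_inv] at h
  have hpos : 0 < ‖w‖⁻¹ := inv_pos.2 (norm_pos_iff.2 hw)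
  by_cases hε : 0 ≤ ε
  · exact (ENNReal.ofReal_le_ofReal_iff hε).1 h
  · rw [ENNReal.ofReal_of_nonpos (not_le.1 hε).le] at h
    exact absurd (ENNReal.ofReal_pos.2 hpos) (not_lt.2 h)

/-- A finite supremum excludes roots on the segment, since `1 / 0 = ∞`. For `r ≥ 0` and `m ≤ k` the
factor `e^{-kr}` is at most `e^{-mr}`, so one sequence of abscissae serves all `k ≥ m`. -/
theorem latticeSup_bound {G : ℂ → ℂ} {m k : ℕ} (hmk : m ≤ k) {r ε : ℝ} (hr : 0 ≤ r)
    (h : latticeSup G m r ≤ ENNReal.ofReal ε) {θ : ℝ} (hθ : θ ∈ Icc (-Real.pi) Real.pi) :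
    G (r + θ * Complex.I) ≠ 1 ∧
      ‖Complex.exp (-(k : ℂ) * (r + θ * Complex.I)) / (1 - G (r + θ * Complex.I))‖ ≤ ε := by
  obtain ⟨h1, h2⟩ := inv_enorm_le_ofReal
    ((le_iSup₂ (f := fun θ (_ : θ ∈ Icc (-Real.pi) Real.pi) =>
      ‖Complex.exp ((m : ℂ) * (r : ℂ)) * (1 - G ((r : ℂ) + (θ : ℂ) * Complex.I))‖ₑ⁻¹) θ hθ).trans h)
  have h3 : 1 - G (r + θ * Complex.I) ≠ 0 := right_ne_zero_of_mul h1
  refine ⟨fun h4 => h3 (by rw [h4, sub_self]), le_trans ?_ h2⟩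
  have e1 : (-(k : ℂ) * (r + θ * Complex.I)).re = -(k * r) := by simp
  have e2 : ((m : ℂ) * (r : ℂ)).re = m * r := by simp
  rw [norm_div, norm_mul, mul_inv, Complex.norm_exp, Complex.norm_exp, e1, e2, ← Real.exp_neg,
    div_eq_mul_inv]
  have hmk' : (m : ℝ) ≤ k := by exact_mod_cast hmk
  gcongr

/-! ### The lattice case -/

section Lattice

variable {F : Measure ℝ} {G : ℂ → ℂ}

/-- For the unit mass at `0` the extension is constantly `1`, and every supremum would be `∞`. -/
theorem compl_singleton_ne_zero_of_liminf [IsProbabilityMeasure F] (hR : 0 < expRadius F)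
    (hG : IsMeromorphicExtension F G) (h : liminf (latticeSup G 1) atTop = 0) :
    F {0}ᶜ ≠ 0 := by
  intro h0
  have hF : ∀ᵐ x ∂F, x = 0 := h0
  have hG1 : G = fun _ => 1 := by
    refine eq_of_eq_left_halfPlane hG.meromorphic
      (fun z _ => analyticAt_const.meromorphicNFAt) fun z hz => ?_
    rw [hG.eq_laplace hR hz.le, laplace, integral_congr_ae (g := fun _ => (1 : ℂ))
      (hF.mono fun x hx => by simp [hx])]
    simp
  obtain ⟨r, -, hr⟩ := exists_seq_of_liminf_eq_zero h
  obtain ⟨n, hn⟩ := (hr.eventually (gt_mem_nhds ENNReal.zero_lt_top)).exists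
  refine hn.ne (top_unique ?_)
  have hmem : (0 : ℝ) ∈ Icc (-Real.pi) Real.pi := ⟨by linarith [Real.pi_pos], Real.pi_pos.le⟩
  refine le_trans ?_ (le_iSup₂ (f := fun θ (_ : θ ∈ Icc (-Real.pi) Real.pi) =>
      ‖Complex.exp (((1 : ℕ) : ℂ) * (r n : ℂ)) *
        (1 - G ((r n : ℂ) + (θ : ℂ) * Complex.I))‖ₑ⁻¹) 0 hmem)
  simp [hG1]

theorem ae_mem_range_natCast (hS : SupportedOnMultiples F 1) :
    F (range ((↑) : ℕ → ℝ))ᶜ = 0 := by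
  simpa [SupportedOnMultiples] using hS

theorem renewalMeasure_compl_range_natCast [IsProbabilityMeasure F]
    (hS : SupportedOnMultiples F 1) : renewalMeasure F (range ((↑) : ℕ → ℝ))ᶜ = 0 := by
  refine renewalMeasure_compl_eq_zero (countable_range _).measurableSet ⟨0, by simp⟩ ?_
    (ae_mem_range_natCast hS)
  rintro _ ⟨a, rfl⟩ _ ⟨b, rfl⟩
  exact ⟨a + b, by simp⟩

theorem renewalMeasure_eq_sum_dirac [IsProbabilityMeasure F] (hF : F (Iio 0) = 0)
    (h0 : F {0}ᶜ ≠ 0) (hS : SupportedOnMultiples F 1) :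
    renewalMeasure F = Measure.sum fun k : ℕ =>
      ENNReal.ofReal ((renewalMeasure F).real {(k : ℝ)}) • Measure.dirac (k : ℝ) := by
  have h1 : (renewalMeasure F).restrict (⋃ k : ℕ, {(k : ℝ)}) = renewalMeasure F := by
    rw [iUnion_singleton_eq_range]
    exact Measure.restrict_eq_self_of_ae_mem (renewalMeasure_compl_range_natCast hS)
  conv_lhs => rw [← h1]
  rw [Measure.restrict_iUnion]
  · congr 1
    ext1 k
    rw [Measure.restrict_singleton, Measure.real, ENNReal.ofReal_toReal]
    exact ((measure_mono (singleton_subset_iff.2 (mem_Iic.2 le_rfl))).trans_lt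
      (renewalMeasure_Iic_lt_top hF h0 (k : ℝ))).ne
  · intro i j hij
    simpa using hij
  · exact fun k => measurableSet_singleton _

/-- `e^{zx}` has period `2πi` in `z` for integer `x`; this passes from the left half-plane to `ℂ` by
the identity theorem. -/
theorem periodic_of_supportedOnMultiples (hR : 0 < expRadius F)
    (hG : IsMeromorphicExtension F G) (hS : SupportedOnMultiples F 1) (z : ℂ) :
    G (z + 2 * Real.pi * Complex.I) = G z := by
  have hS' : ∀ᵐ x ∂F, x ∈ range ((↑) : ℕ → ℝ) := ae_mem_range_natCast hS
  have h : (fun z => G (z + 2 * Real.pi * Complex.I)) = G := by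
    refine eq_of_eq_left_halfPlane ?_ hG.meromorphic fun z hz => ?_
    · intro z _
      exact (meromorphicNFAt_comp_add_const_iff_meromorphicNFAt (f := G)).2
        (hG.meromorphic (mem_univ _))
    · have hz' : (z + 2 * Real.pi * Complex.I).re ≤ 0 := by simpa using hz.le
      rw [hG.eq_laplace hR hz', hG.eq_laplace hR hz.le]
      refine integral_congr_ae (hS'.mono ?_)
      rintro _ ⟨n, rfl⟩
      have : (z + 2 * Real.pi * Complex.I) * ((n : ℝ) : ℂ) =
          z * ((n : ℝ) : ℂ) + n * (2 * Real.pi * Complex.I) := by push_cast; ring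
      simp only
      rw [this, Complex.exp_add, Complex.exp_nat_mul_two_pi_mul_I, mul_one]
  exact congrFun h z

theorem integral_cexp_int (j : ℤ) :
    ∫ θ : ℝ in (-Real.pi)..Real.pi, Complex.exp ((-1 + θ * Complex.I) * j) =
      if j = 0 then 2 * (Real.pi : ℂ) else 0 := by
  split_ifs with hj
  · subst hj
    simp
    ring
  · have hj' : (j : ℂ) ≠ 0 := by exact_mod_cast hj
    have e : ∀ θ : ℝ, Complex.exp ((-1 + θ * Complex.I) * j) =
        Complex.exp (-j) * Complex.exp ((j * Complex.I) * θ) := fun θ => by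
      rw [← Complex.exp_add]; congr 1; ring
    simp only [e]
    rw [intervalIntegral.integral_const_mul, integral_exp_mul_complex
      (mul_ne_zero hj' Complex.I_ne_zero)]
    have h2 : (j : ℂ) * Complex.I * (Real.pi : ℝ) =
        (j : ℂ) * Complex.I * ((-Real.pi : ℝ) : ℂ) + j * (2 * Real.pi * Complex.I) := by
      push_cast; ring
    rw [h2, Complex.exp_add, Complex.exp_int_mul_two_pi_mul_I, mul_one, sub_self, zero_div,
      mul_zero]

/-- Orthogonality of the characters `e^{ijθ}` picks out the mass at `k`. The integrals may be
exchanged because on `Re z = -1` the integrand has modulus `e^{k - y}`, which is integrable for `U`.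
-/
theorem integral_vertical_eq_mass [IsProbabilityMeasure F] (hF : F (Iio 0) = 0)
    (h0 : F {0}ᶜ ≠ 0) (hR : 0 < expRadius F) (hG : IsMeromorphicExtension F G)
    (hS : SupportedOnMultiples F 1) (k : ℕ) :
    ∫ θ in (-Real.pi)..Real.pi, Complex.exp (-(k : ℂ) * (((-1 : ℝ) : ℂ) + θ * Complex.I)) /
      (1 - G (((-1 : ℝ) : ℂ) + θ * Complex.I)) =
        2 * Real.pi * ((renewalMeasure F).real {(k : ℝ)} : ℂ) := by
  have hle : -Real.pi ≤ Real.pi := by linarith [Real.pi_pos]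
  have hS' : ∀ᵐ x ∂renewalMeasure F, x ∈ range ((↑) : ℕ → ℝ) :=
    renewalMeasure_compl_range_natCast hS
  have e1 : ∀ θ : ℝ, Complex.exp (-(k : ℂ) * (((-1 : ℝ) : ℂ) + θ * Complex.I)) /
      (1 - G (((-1 : ℝ) : ℂ) + θ * Complex.I)) =
      ∫ y : ℝ, Complex.exp ((-1 + θ * Complex.I) * (y - k)) ∂renewalMeasure F := by
    intro θ
    have hre : (((-1 : ℝ) : ℂ) + θ * Complex.I).re < 0 := by simp
    rw [hG.eq_laplace hR hre.le, div_eq_mul_one_div, ← laplace_renewalMeasure hF h0 hre, laplace,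
      ← integral_const_mul]
    congr 1
    ext y
    rw [← Complex.exp_add]
    congr 1
    push_cast
    ring
  simp only [e1]
  rw [intervalIntegral.integral_of_le hle, integral_integral_swap]
  · have e2 : ∀ᵐ y : ℝ ∂renewalMeasure F,
        ∫ θ : ℝ in Ioc (-Real.pi) Real.pi, Complex.exp ((-1 + θ * Complex.I) * (y - k)) =
          ({(k : ℝ)} : Set ℝ).indicator (fun _ => 2 * (Real.pi : ℂ)) y := by
      filter_upwards [hS'] with y hy
      obtain ⟨n, rfl⟩ := hy
      rw [← intervalIntegral.integral_of_le hle]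
      have h := integral_cexp_int ((n : ℤ) - (k : ℤ))
      push_cast at h
      push_cast
      rw [h]
      by_cases hnk : n = k
      · simp [hnk]
      · have h2 : ((n : ℤ) - (k : ℤ)) ≠ 0 := by omega
        have h3 : (n : ℝ) ≠ k := by exact_mod_cast hnk
        simp [h2, h3]
    rw [integral_congr_ae e2, integral_indicator (measurableSet_singleton _), setIntegral_const]
    rw [Complex.real_smul]
    ring
  · have h1 : Integrable (fun y : ℝ => Real.exp k * Real.exp (-1 * y)) (renewalMeasure F) :=
      (integrable_exp_renewalMeasure hF h0 one_pos).const_mul _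
    have h2 : Integrable (fun _ : ℝ => (1 : ℝ)) (volume.restrict (Ioc (-Real.pi) Real.pi)) :=
      integrable_const _
    refine (h2.mul_prod h1).mono' (by fun_prop) (Eventually.of_forall ?_)
    rintro ⟨θ, y⟩
    simp only [Function.uncurry]
    rw [Complex.norm_exp, one_mul, ← Real.exp_add]
    refine le_of_eq ?_
    congr 1
    simp
    ring

theorem finite_stripRoots_lt [IsProbabilityMeasure F] (hF : F (Iio 0) = 0)
    (h0 : F {0}ᶜ ≠ 0) (hR : 0 < expRadius F) (hG : IsMeromorphicExtension F G) (ρ : ℝ) :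
    {z | z ∈ stripRoots G ∧ z.re < ρ}.Finite :=
  (hG.finite_roots_inter hF h0 hR ρ Real.pi).subset fun _ hz =>
    ⟨hz.1.1, hz.2.le, abs_le.2 ⟨hz.1.2.1.le, hz.1.2.2⟩⟩

theorem norm_sum_residue_sub_mass_le [IsProbabilityMeasure F] (hF : F (Iio 0) = 0)
    (h0 : F {0}ᶜ ≠ 0) (hR : 0 < expRadius F) (hG : IsMeromorphicExtension F G)
    (hS : SupportedOnMultiples F 1) {k m : ℕ} (hmk : m ≤ k) {r ε : ℝ} (hr : 0 ≤ r)
    (h : latticeSup G m r ≤ ENNReal.ofReal ε) :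
    ‖(∑ᶠ z ∈ {z | z ∈ stripRoots G ∧ z.re < r},
        -residue (fun z => Complex.exp (-(k : ℂ) * z) / (1 - G z)) z) -
      ((renewalMeasure F).real {(k : ℝ)} : ℂ)‖ ≤ ε := by
  set f : ℂ → ℂ := fun z => Complex.exp (-(k : ℂ) * z) / (1 - G z) with hf
  have hfin := finite_stripRoots_lt hF h0 hR hG r
  have hper := periodic_of_supportedOnMultiples hR hG hS
  have han : ∀ z, AnalyticAt ℂ (fun z => Complex.exp (-(k : ℂ) * z)) z := fun z => by fun_prop
  have key := integral_vertical_sub_eq_sum_residue hfin.toFinset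
    (by linarith : (-1 : ℝ) ≤ r) f (hG.meromorphic_div han)
    (fun z => by
      have : -(k : ℂ) * (z + 2 * Real.pi * Complex.I) =
          -(k : ℂ) * z - k * (2 * Real.pi * Complex.I) := by ring
      simp only [hf]
      rw [hper, this, Complex.exp_sub, Complex.exp_nat_mul_two_pi_mul_I, div_one])
    (fun w hw => by
      rw [Set.Finite.mem_toFinset] at hw
      have := hG.re_nonneg_of_eq_one hF h0 hR hw.1.1
      exact ⟨by linarith, hw.2, hw.1.2.1, hw.1.2.2⟩)
    (fun z h1 h2 h3 h4 hz => by
      refine hG.order_div_nonneg (han z) fun hz1 => ?_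
      rw [Set.Finite.mem_toFinset] at hz
      rcases h2.lt_or_eq with h2 | h2
      · exact hz ⟨⟨hz1, h3, h4⟩, h2⟩
      -- The residue theorem counts poles strictly left of `r`; a root on the line `Re z = r` would
      -- make the supremum infinite.
      · refine (latticeSup_bound hmk hr h ⟨h3.le, h4⟩).1 ?_
        rw [← h2, Complex.re_add_im, hz1])
  rw [integral_vertical_eq_mass hF h0 hR hG hS k] at key
  have hpi : (2 * Real.pi : ℂ) ≠ 0 := by
    simp [Real.pi_ne_zero]
  rw [finsum_mem_eq_finite_toFinset_sum _ hfin, Finset.sum_neg_distrib]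
  have e : -∑ w ∈ hfin.toFinset, residue f w - ((renewalMeasure F).real {(k : ℝ)} : ℂ) =
      -((2 * Real.pi : ℂ)⁻¹ * ∫ θ in (-Real.pi)..Real.pi, f (r + θ * Complex.I)) := by
    have := congrArg (fun z => (2 * Real.pi : ℂ)⁻¹ * z) key
    simp only [mul_sub, inv_mul_cancel_left₀ hpi] at this
    linear_combination this
  rw [e, norm_neg, norm_mul]
  have hb : ‖∫ θ in (-Real.pi)..Real.pi, f (r + θ * Complex.I)‖ ≤ ε * |Real.pi - -Real.pi| := by
    refine intervalIntegral.norm_integral_le_of_norm_le_const fun θ hθ => ?_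
    rw [uIoc_of_le (by linarith [Real.pi_pos])] at hθ
    exact (latticeSup_bound hmk hr h ⟨hθ.1.le, hθ.2⟩).2
  have hn : ‖(2 * Real.pi : ℂ)⁻¹‖ = (2 * Real.pi)⁻¹ := by
    simp [abs_of_pos Real.pi_pos]
  rw [hn]
  have hpp : Real.pi - -Real.pi = 2 * Real.pi := by ring
  rw [hpp, abs_of_pos Real.two_pi_pos] at hb
  calc (2 * Real.pi)⁻¹ * ‖∫ θ in (-Real.pi)..Real.pi, f (r + θ * Complex.I)‖
      ≤ (2 * Real.pi)⁻¹ * (ε * (2 * Real.pi)) := by gcongr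
    _ = ε := by field_simp

theorem isOrderedRootSum_residue [IsProbabilityMeasure F] (hF : F (Iio 0) = 0)
    (h0 : F {0}ᶜ ≠ 0) (hR : 0 < expRadius F) (hG : IsMeromorphicExtension F G)
    (hS : SupportedOnMultiples F 1) {k m : ℕ} (hmk : m ≤ k)
    (hlim : liminf (latticeSup G m) atTop = 0) :
    IsOrderedRootSum G m
      (fun w => -residue (fun z => Complex.exp (-(k : ℂ) * z) / (1 - G z)) w)
      ((renewalMeasure F).real {(k : ℝ)} : ℂ) := by
  refine isOrderedRootSum_of_tendsto (finite_stripRoots_lt hF h0 hR hG)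
    (exists_seq_of_liminf_eq_zero hlim) fun r hr hl => ?_
  rw [Metric.tendsto_nhds]
  intro ε hε
  filter_upwards [hr.eventually_ge_atTop 0,
    hl.eventually (gt_mem_nhds (ENNReal.ofReal_pos.2 (half_pos hε)))] with n h1 h2
  rw [dist_eq_norm]
  exact (norm_sum_residue_sub_mass_le hF h0 hR hG hS hmk h1 h2.le).trans_lt (half_lt_self hε)

/-- For `m = 0` no separate clause about poles is needed: `G` is `0` at a pole, which forces a
supremum of at least `1` on that segment, so good abscissae eventually avoid the poles. -/
theorem lattice_case [IsProbabilityMeasure F] (hF : F (Iio 0) = 0) (hR : 0 < expRadius F)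
    (hG : IsMeromorphicExtension F G) (hS : SupportedOnMultiples F 1)
    (hlim : liminf (latticeSup G 1) atTop = 0) :
    ∃ u : ℕ → ℝ, (∀ k, 0 ≤ u k) ∧
      renewalMeasure F = Measure.sum (fun k : ℕ => ENNReal.ofReal (u k) • Measure.dirac (k : ℝ)) ∧
      ∀ k m : ℕ, (1 ≤ k ∧ m = 1 ∨ k = 0 ∧ m = 0 ∧ liminf (latticeSup G 0) atTop = 0) →
        IsOrderedRootSum G m
          (fun w => -residue (fun z => Complex.exp (-(k : ℂ) * z) / (1 - G z)) w) (u k : ℂ) ∧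
        ((∀ w ∈ stripRoots G, deriv G w ≠ 0) →
          IsOrderedRootSum G m (fun w => Complex.exp (-(k : ℂ) * w) / deriv G w) (u k : ℂ)) := by
  have h0 := compl_singleton_ne_zero_of_liminf hR hG hlim
  refine ⟨fun k => (renewalMeasure F).real {(k : ℝ)}, fun k => measureReal_nonneg,
    renewalMeasure_eq_sum_dirac hF h0 hS, fun k m hkm => ?_⟩
  have hsum : IsOrderedRootSum G m
      (fun w => -residue (fun z => Complex.exp (-(k : ℂ) * z) / (1 - G z)) w)
      ((renewalMeasure F).real {(k : ℝ)} : ℂ) := by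
    rcases hkm with ⟨hk, rfl⟩ | ⟨rfl, rfl, h⟩
    · exact isOrderedRootSum_residue hF h0 hR hG hS hk hlim
    · exact isOrderedRootSum_residue hF h0 hR hG hS le_rfl h
  refine ⟨hsum, fun hd => hsum.congr fun w hw => ?_⟩
  rw [hG.residue_div (h := fun z => Complex.exp (-(k : ℂ) * z)) (by fun_prop) hw.1 (hd w hw),
    neg_neg]

end Lattice

/-! ### The Cauchy density and Fourier inversion for the ramp function -/

theorem inv_sq_add_sq_eq {r : ℝ} (hr : r ≠ 0) (θ : ℝ) :
    (r ^ 2 + θ ^ 2)⁻¹ = (r ^ 2)⁻¹ * (1 + (r⁻¹ * θ) ^ 2)⁻¹ := by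
  rw [← mul_inv]
  congr 1
  field_simp

theorem integrable_inv_sq_add_sq {r : ℝ} (hr : r ≠ 0) :
    Integrable fun θ : ℝ => (r ^ 2 + θ ^ 2)⁻¹ := by
  simp only [inv_sq_add_sq_eq hr]
  exact (integrable_inv_one_add_sq.comp_mul_left' (inv_ne_zero hr)).const_mul _

theorem integral_inv_sq_add_sq {r : ℝ} (hr : r ≠ 0) :
    ∫ θ : ℝ, (r ^ 2 + θ ^ 2)⁻¹ = Real.pi / |r| := by
  simp only [inv_sq_add_sq_eq hr]
  rw [integral_const_mul, Measure.integral_comp_mul_left (fun x => (1 + x ^ 2)⁻¹),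
    integral_univ_inv_one_add_sq, inv_inv, smul_eq_mul, ← sq_abs r]
  have : |r| ≠ 0 := abs_ne_zero.2 hr
  field_simp

theorem norm_sq_vertical (r θ : ℝ) : ‖(r : ℂ) + θ * Complex.I‖ ^ 2 = r ^ 2 + θ ^ 2 := by
  rw [Complex.sq_norm, Complex.normSq_add_mul_I]

theorem vertical_ne_zero {r : ℝ} (hr : r ≠ 0) (θ : ℝ) : (r : ℂ) + θ * Complex.I ≠ 0 := by
  intro h
  have := congrArg Complex.re h
  simp at this
  exact hr this

section Inversion

variable {a : ℝ}

theorem continuous_ramp (a : ℝ) :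
    Continuous fun y : ℝ => ((max y 0 * Real.exp (-a * y) : ℝ) : ℂ) := by fun_prop

/-- Half of the exponential absorbs the factor `y`, by `1 + t ≤ e^t` at `t = ay / 2`. -/
theorem mul_exp_neg_le (ha : 0 < a) (y : ℝ) :
    y * Real.exp (-a * y) ≤ 2 / a * Real.exp (-(a / 2) * y) := by
  have h2 := Real.add_one_le_exp (a / 2 * y)
  have h3 : Real.exp (-a * y) = Real.exp (-(a / 2) * y) * Real.exp (-(a / 2) * y) := by
    rw [← Real.exp_add]; congr 1; ring
  have h4 : Real.exp (-(a / 2) * y) * Real.exp (a / 2 * y) = 1 := by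
    rw [← Real.exp_add]; simp
  have h5 : y * Real.exp (-(a / 2) * y) ≤ 2 / a := by
    rw [le_div_iff₀ ha]
    have h6 := Real.exp_pos (-(a / 2) * y)
    nlinarith
  rw [h3, ← mul_assoc]
  gcongr

theorem integrable_ramp (ha : 0 < a) :
    Integrable fun y : ℝ => max y 0 * Real.exp (-a * y) := by
  have h1 : IntegrableOn (fun y : ℝ => 2 / a * Real.exp (-(a / 2) * y)) (Ioi 0) :=
    (integrableOn_exp_mul_Ioi (by linarith) 0).const_mul _
  rw [← integrable_indicator_iff measurableSet_Ioi] at h1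
  refine h1.mono' (by fun_prop) (Eventually.of_forall fun y => ?_)
  rw [Real.norm_of_nonneg (by positivity)]
  by_cases hy : 0 < y
  · rw [indicator_of_mem (mem_Ioi.2 hy), max_eq_left hy.le]
    exact mul_exp_neg_le ha y
  · rw [max_eq_right (not_lt.1 hy), zero_mul]
    exact indicator_nonneg (fun _ _ => by positivity) _

theorem tendsto_exp_neg_mul_atTop (ha : 0 < a) :
    Tendsto (fun y : ℝ => Real.exp (-a * y)) atTop (𝓝 0) := by
  refine Real.tendsto_exp_atBot.comp ?_
  exact tendsto_id.const_mul_atTop_of_neg (neg_lt_zero.2 ha)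

theorem integral_mul_cexp_neg_mul_Ioi {c : ℂ} (hc : 0 < c.re) :
    ∫ y : ℝ in Ioi 0, (y : ℂ) * Complex.exp (-c * y) = 1 / c ^ 2 := by
  have hc0 : c ≠ 0 := by rintro rfl; simp at hc
  have hnorm : ∀ y : ℝ, ‖Complex.exp (-c * y)‖ = Real.exp (-c.re * y) := fun y => by
    rw [Complex.norm_exp]; simp
  have hd : ∀ y : ℝ, HasDerivAt (fun y : ℝ => -(1 / c * (y * Complex.exp (-c * y)) +
      1 / c ^ 2 * Complex.exp (-c * y))) ((y : ℂ) * Complex.exp (-c * y)) y := by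
    intro y
    have h1 : HasDerivAt (fun y : ℝ => (y : ℂ)) 1 y := Complex.ofRealCLM.hasDerivAt (x := y)
    have h2 := (h1.const_mul (-c)).cexp
    have h3 := (((h1.mul h2).const_mul (1 / c)).add (h2.const_mul (1 / c ^ 2))).neg
    refine h3.congr_deriv ?_
    field_simp
    ring
  have ht1 : Tendsto (fun y : ℝ => (y : ℂ) * Complex.exp (-c * y)) atTop (𝓝 0) := by
    rw [tendsto_zero_iff_norm_tendsto_zero]
    have hlim : Tendsto (fun y : ℝ => 2 / c.re * Real.exp (-(c.re / 2) * y)) atTop (𝓝 0) := by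
      simpa using (tendsto_exp_neg_mul_atTop (half_pos hc)).const_mul (2 / c.re)
    refine squeeze_zero' (Eventually.of_forall fun y => norm_nonneg _) ?_ hlim
    filter_upwards [eventually_ge_atTop 0] with y hy
    rw [norm_mul, hnorm, Complex.norm_real, Real.norm_of_nonneg hy]
    exact mul_exp_neg_le hc y
  have ht2 : Tendsto (fun y : ℝ => Complex.exp (-c * y)) atTop (𝓝 0) := by
    rw [tendsto_zero_iff_norm_tendsto_zero]
    simp only [hnorm]
    exact tendsto_exp_neg_mul_atTop hc
  have ht : Tendsto (fun y : ℝ => -(1 / c * (y * Complex.exp (-c * y)) +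
      1 / c ^ 2 * Complex.exp (-c * y))) atTop (𝓝 0) := by
    have h := ((ht1.const_mul (1 / c)).add (ht2.const_mul (1 / c ^ 2))).neg
    rwa [mul_zero, mul_zero, add_zero, neg_zero] at h
  have hint : IntegrableOn (fun y : ℝ => (y : ℂ) * Complex.exp (-c * y)) (Ioi 0) := by
    have hcont : Continuous fun y : ℝ => (y : ℂ) * Complex.exp (-c * y) := by fun_prop
    refine Integrable.mono' (integrable_ramp hc).integrableOn hcont.aestronglyMeasurable ?_
    filter_upwards [ae_restrict_mem measurableSet_Ioi] with y hy
    have hy' : 0 < y := hy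
    rw [norm_mul, hnorm, Complex.norm_real, max_eq_left hy'.le, Real.norm_of_nonneg hy'.le]
  rw [integral_Ioi_of_hasDerivAt_of_tendsto' (fun y _ => hd y) hint ht]
  simp

open FourierTransform in
-- The ramp is used because its transform decays like `θ⁻²`. It is continuous with integrable
-- transform, so pointwise inversion applies; a jump function would give only `θ⁻¹`.
theorem fourier_ramp (ha : 0 < a) (ξ : ℝ) :
    𝓕 (fun y : ℝ => ((max y 0 * Real.exp (-a * y) : ℝ) : ℂ)) ξ =
      1 / ((a : ℂ) + (2 * Real.pi * ξ : ℝ) * Complex.I) ^ 2 := by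
  rw [Real.fourier_real_eq_integral_exp_smul]
  have hre : 0 < ((a : ℂ) + (2 * Real.pi * ξ : ℝ) * Complex.I).re := by simpa using ha
  rw [← integral_mul_cexp_neg_mul_Ioi hre, ← integral_indicator measurableSet_Ioi]
  congr 1
  ext y
  by_cases hy : 0 < y
  · rw [indicator_of_mem (mem_Ioi.2 hy), max_eq_left hy.le, smul_eq_mul]
    push_cast
    rw [mul_left_comm, ← Complex.exp_add]
    congr 2
    ring
  · rw [indicator_of_notMem (by simpa using hy), max_eq_right (not_lt.1 hy)]
    simp

theorem norm_inv_sq_vertical (r θ : ℝ) :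
    ‖1 / ((r : ℂ) + θ * Complex.I) ^ 2‖ = (r ^ 2 + θ ^ 2)⁻¹ := by
  rw [norm_div, norm_one, norm_pow, norm_sq_vertical, one_div]

open FourierTransform in
theorem integral_cexp_div_sq_pos (ha : 0 < a) (y : ℝ) :
    ∫ θ : ℝ, Complex.exp (θ * Complex.I * y) * (1 / ((a : ℂ) + θ * Complex.I) ^ 2) =
      2 * Real.pi * ((max y 0 * Real.exp (-a * y) : ℝ) : ℂ) := by
  have hint : Integrable fun θ : ℝ => 1 / ((a : ℂ) + (θ : ℂ) * Complex.I) ^ 2 := by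
    refine (integrable_inv_sq_add_sq ha.ne').mono' ?_
      (Eventually.of_forall fun θ => (norm_inv_sq_vertical a θ).le)
    exact (by fun_prop : Measurable fun θ : ℝ => 1 / ((a : ℂ) + (θ : ℂ) * Complex.I) ^
      2).aestronglyMeasurable
  have h1 := congrFun ((continuous_ramp a).fourierInv_fourier_eq (integrable_ramp ha).ofReal (by
    simp only [funext (fourier_ramp ha)]
    exact hint.comp_mul_left' (by positivity : (2 * Real.pi : ℝ) ≠ 0))) y
  rw [← h1, Real.fourierInv_eq']
  simp only [fourier_ramp ha]
  have h2 := Measure.integral_comp_mul_left (fun θ : ℝ =>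
    Complex.exp (θ * Complex.I * y) * (1 / ((a : ℂ) + θ * Complex.I) ^ 2)) (2 * Real.pi)
  rw [abs_of_pos (by positivity), Complex.real_smul] at h2
  have h3 : ∀ I J : ℂ, J = ((2 * Real.pi)⁻¹ : ℝ) * I → I = 2 * Real.pi * J := by
    rintro I J rfl
    have : (Real.pi : ℂ) ≠ 0 := by exact_mod_cast Real.pi_ne_zero
    push_cast
    field_simp
  refine h3 _ _ (Eq.trans ?_ h2)
  congr 1
  ext ξ
  rw [smul_eq_mul]
  congr 2
  simp only [RCLike.inner_apply, conj_trivial]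
  push_cast
  ring

theorem integral_cexp_div_sq (ha : 0 < a) (y : ℝ) :
    ∫ θ : ℝ, Complex.exp ((((-a : ℝ) : ℂ) + θ * Complex.I) * y) /
      (((-a : ℝ) : ℂ) + θ * Complex.I) ^ 2 = 2 * Real.pi * ((max (-y) 0 : ℝ) : ℂ) := by
  -- Replacing `θ` by `-θ` turns `-a + iθ` into `-(a + iθ)`. The factor `e^{-ay}` then cancels the
  -- damping in the inversion formula at `-y`.
  rw [← integral_neg_eq_self]
  have h := congrArg (fun t => Complex.exp (-a * y) * t) (integral_cexp_div_sq_pos ha (-y))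
  rw [← integral_const_mul] at h
  convert h using 1
  · congr 1
    ext θ
    have e : ((((-a : ℝ) : ℂ) + ((-θ : ℝ) : ℂ) * Complex.I) ^ 2) =
        ((a : ℂ) + θ * Complex.I) ^ 2 := by push_cast; ring
    rw [e, ← mul_assoc, ← Complex.exp_add, mul_one_div]
    congr 2
    push_cast
    ring
  · push_cast
    have : Complex.exp (-a * y) * Complex.exp (-a * -y) = 1 := by
      rw [← Complex.exp_add]; simp
    linear_combination (-2 * Real.pi * ((max (-y) 0 : ℝ) : ℂ)) * this

end Inversion

/-! ### The kernel -/

/-- The entire function `(1 - e^{-pz}) / z`. -/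
noncomputable def expQuot (p : ℝ) (z : ℂ) : ℂ := -dslope (fun z : ℂ => Complex.exp (-p * z)) 0 z

theorem expQuot_of_ne (p : ℝ) {z : ℂ} (hz : z ≠ 0) :
    expQuot p z = (1 - Complex.exp (-p * z)) / z := by
  rw [expQuot, dslope_of_ne _ hz, slope_def_field]
  simp only [mul_zero, Complex.exp_zero, sub_zero]
  ring

theorem expQuot_zero (p : ℝ) : expQuot p 0 = p := by
  have h : HasDerivAt (fun z : ℂ => Complex.exp (-p * z)) (-p) 0 := by
    have := ((hasDerivAt_id (0 : ℂ)).const_mul (-p : ℂ)).cexp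
    simpa using this
  rw [expQuot, dslope_same, h.deriv, neg_neg]

theorem expQuot_analyticAt (p : ℝ) (z : ℂ) : AnalyticAt ℂ (expQuot p) z := by
  have hd : DifferentiableOn ℂ (dslope (fun z : ℂ => Complex.exp (-p * z)) 0) univ :=
    (Complex.differentiableOn_dslope univ_mem).2 (by fun_prop)
  exact (hd.analyticAt univ_mem).neg

theorem expQuot_eq_integral (p : ℝ) (z : ℂ) :
    expQuot p z = ∫ t in (0 : ℝ)..p, Complex.exp (-t * z) := by
  by_cases hz : z = 0
  · subst hz
    simp [expQuot_zero]
  · have e : ∀ t : ℝ, Complex.exp (-t * z) = Complex.exp (-z * t) := fun t => by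
      congr 1; ring
    simp only [e]
    rw [integral_exp_mul_complex (neg_ne_zero.2 hz), expQuot_of_ne p hz]
    simp only [Complex.ofReal_zero, mul_zero, Complex.exp_zero]
    rw [show -z * (p : ℂ) = -p * z by ring]
    field_simp
    ring

/-- For use at the roots: the bound is linear in `p`, so that division by the width leaves a
dominating series. -/
theorem norm_expQuot_le {p : ℝ} (hp : 0 ≤ p) {z : ℂ} (hz : 0 ≤ z.re) : ‖expQuot p z‖ ≤ p := by
  rw [expQuot_eq_integral]
  have := intervalIntegral.norm_integral_le_of_norm_le_const (a := (0 : ℝ)) (b := p)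
    (f := fun t : ℝ => Complex.exp (-t * z)) (C := 1) fun t ht => by
      rw [uIoc_of_le hp] at ht
      rw [Complex.norm_exp, Real.exp_le_one_iff]
      have := mul_nonneg ht.1.le hz
      simpa using this
  simpa [abs_of_nonneg hp] using this

/-- For use on vertical lines: two such factors give the decay `|z|⁻²`. -/
theorem norm_expQuot_le_div {p b : ℝ} (hp : 0 ≤ p) {z : ℂ} (hz : z ≠ 0) (hb : -b ≤ z.re) :
    ‖expQuot p z‖ ≤ (1 + Real.exp (p * b)) / ‖z‖ := by
  rw [expQuot_of_ne p hz, norm_div]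
  gcongr
  refine (norm_sub_le _ _).trans ?_
  rw [norm_one, Complex.norm_exp]
  gcongr
  have : (-(p : ℂ) * z).re = -(p * z.re) := by simp
  rw [this]
  nlinarith

theorem tendsto_expQuot_div (z : ℂ) :
    Tendsto (fun q : ℝ => expQuot q z / q) (𝓝[>] 0) (𝓝 1) := by
  have h : HasDerivAt (fun b : ℝ => ∫ t in (0 : ℝ)..b, Complex.exp (-t * z)) 1 0 := by
    have hc : Continuous fun t : ℝ => Complex.exp (-t * z) := by fun_prop
    simpa using (hc.integral_hasStrictDerivAt (0 : ℝ) 0).hasDerivAt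
  rw [hasDerivAt_iff_tendsto_slope] at h
  refine (h.mono_left (nhdsWithin_mono _ fun x hx => (ne_of_gt hx : x ≠ 0))).congr fun q => ?_
  rw [slope_def_module, expQuot_eq_integral]
  simp only [intervalIntegral.integral_same, sub_zero, Complex.real_smul]
  push_cast
  ring

/-- The entire kernel `e^{-xz} (1 - e^{-pz}) (1 - e^{-qz}) / z²`. -/
noncomputable def boxKernel (x p q : ℝ) (z : ℂ) : ℂ :=
  Complex.exp (-x * z) * (expQuot p z * expQuot q z)

theorem boxKernel_analyticAt (x p q : ℝ) (z : ℂ) : AnalyticAt ℂ (boxKernel x p q) z := by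
  have h : AnalyticAt ℂ (fun z : ℂ => Complex.exp (-x * z)) z := by fun_prop
  exact h.mul ((expQuot_analyticAt p z).mul (expQuot_analyticAt q z))

theorem boxKernel_of_ne (x p q : ℝ) {z : ℂ} (hz : z ≠ 0) :
    boxKernel x p q z = Complex.exp (-x * z) / z ^ 2 - Complex.exp (-(x + p : ℝ) * z) / z ^ 2 -
      Complex.exp (-(x + q : ℝ) * z) / z ^ 2 + Complex.exp (-(x + p + q : ℝ) * z) / z ^ 2 := by
  rw [boxKernel, expQuot_of_ne p hz, expQuot_of_ne q hz]
  have e1 : Complex.exp (-(x + p : ℝ) * z) = Complex.exp (-x * z) * Complex.exp (-p * z) := by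
    rw [← Complex.exp_add]; congr 1; push_cast; ring
  have e2 : Complex.exp (-(x + q : ℝ) * z) = Complex.exp (-x * z) * Complex.exp (-q * z) := by
    rw [← Complex.exp_add]; congr 1; push_cast; ring
  have e3 : Complex.exp (-(x + p + q : ℝ) * z) =
      Complex.exp (-x * z) * Complex.exp (-p * z) * Complex.exp (-q * z) := by
    rw [← Complex.exp_add, ← Complex.exp_add]; congr 1; push_cast; ring
  rw [e1, e2, e3]
  field_simp
  ring

theorem norm_boxKernel_le {x p q b : ℝ} (hx : 0 ≤ x) (hp : 0 ≤ p) (hq : 0 ≤ q) {z : ℂ}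
    (hz : z ≠ 0) (hb : -b ≤ z.re) : ‖boxKernel x p q z‖ ≤
      Real.exp (x * b) * ((1 + Real.exp (p * b)) * (1 + Real.exp (q * b))) / ‖z‖ ^ 2 := by
  rw [boxKernel, norm_mul, norm_mul, Complex.norm_exp]
  have h1 : (-(x : ℂ) * z).re ≤ x * b := by
    have : (-(x : ℂ) * z).re = -(x * z.re) := by simp
    rw [this]
    nlinarith
  calc _ ≤ Real.exp (x * b) * ((1 + Real.exp (p * b)) / ‖z‖ * ((1 + Real.exp (q * b)) / ‖z‖)) := by
        gcongr
        · exact norm_expQuot_le_div hp hz hb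
        · exact norm_expQuot_le_div hq hz hb
    _ = _ := by ring

/-! ### Vertical integrals of a simple pole -/

/-- The integrand is not absolutely integrable. Symmetric truncation cancels its odd part and leaves
`s / (s² + y²)`, with limit `π` or `-π` according to the sign of `s`. -/
theorem tendsto_integral_vertical_inv {s : ℝ} (hs : s ≠ 0) :
    Tendsto (fun T : ℝ => ∫ y in -T..T, ((s : ℂ) + y * Complex.I)⁻¹) atTop
      (𝓝 (s * (Real.pi / |s|) : ℝ)) := by
  have hc : Continuous fun y : ℝ => ((s : ℂ) + y * Complex.I)⁻¹ :=
    Continuous.inv₀ (by fun_prop) fun y => vertical_ne_zero hs y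
  have h1 : ∀ T : ℝ, ∫ y in -T..T, ((s : ℂ) + y * Complex.I)⁻¹ =
      ((∫ y in -T..T, s * (s ^ 2 + y ^ 2)⁻¹ : ℝ) : ℂ) := by
    intro T
    have h2 : ∫ y in -T..T, ((s : ℂ) + ((-y : ℝ) : ℂ) * Complex.I)⁻¹ =
        ∫ y in -T..T, ((s : ℂ) + y * Complex.I)⁻¹ := by
      have := intervalIntegral.integral_comp_neg (a := -T) (b := T)
        (fun y : ℝ => ((s : ℂ) + y * Complex.I)⁻¹)
      rwa [neg_neg] at this
    have h3 := intervalIntegral.integral_add (hc.intervalIntegrable (-T) T)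
      ((hc.comp continuous_neg).intervalIntegrable (-T) T) (μ := volume)
    simp only [Function.comp_def] at h3
    rw [h2, ← two_mul] at h3
    rw [← intervalIntegral.integral_ofReal]
    have h4 : ∫ y in -T..T, (((s : ℂ) + y * Complex.I)⁻¹ +
        ((s : ℂ) + ((-y : ℝ) : ℂ) * Complex.I)⁻¹) =
        2 * ∫ y in -T..T, ((s * (s ^ 2 + y ^ 2)⁻¹ : ℝ) : ℂ) := by
      rw [← intervalIntegral.integral_const_mul]
      refine intervalIntegral.integral_congr fun y _ => ?_
      have hy1 := vertical_ne_zero hs y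
      have hy2 := vertical_ne_zero hs (-y)
      have hy3 : (s : ℂ) ^ 2 + (y : ℂ) ^ 2 =
          ((s : ℂ) + y * Complex.I) * ((s : ℂ) + ((-y : ℝ) : ℂ) * Complex.I) := by
        push_cast
        linear_combination (y : ℂ) ^ 2 * Complex.I_sq
      push_cast at hy2 hy3 ⊢
      have hy4 : 2 * (s : ℂ) = ((s : ℂ) + y * Complex.I) + ((s : ℂ) + -y * Complex.I) := by ring
      rw [hy3, ← mul_assoc, hy4]
      generalize (s : ℂ) + y * Complex.I = A at hy1
      generalize (s : ℂ) + -y * Complex.I = B at hy2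
      field_simp
      ring
    rw [h4] at h3
    exact (mul_left_cancel₀ two_ne_zero h3).symm
  simp only [h1]
  refine (Complex.continuous_ofReal.tendsto _).comp ?_
  rw [← integral_inv_sq_add_sq hs, ← integral_const_mul]
  exact intervalIntegral_tendsto_integral ((integrable_inv_sq_add_sq hs).const_mul s)
    tendsto_neg_atTop_atBot tendsto_id

/-! ### The non-lattice case: integrals over vertical lines -/

section NonLattice

variable {F : Measure ℝ} {G : ℂ → ℂ}

/-- `∫ (x - y)⁺ dU(y)`. -/
noncomputable def rampMass (F : Measure ℝ) (x : ℝ) : ℝ :=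
  ∫ y : ℝ, max (x - y) 0 ∂renewalMeasure F

theorem measurable_vertical (hG : IsMeromorphicExtension F G) (r : ℝ) :
    Measurable fun θ : ℝ => G ((r : ℂ) + θ * Complex.I) :=
  hG.meromorphic'.measurable.comp (by fun_prop)

theorem norm_inv_one_sub_le_left [IsProbabilityMeasure F] (hF : F (Iio 0) = 0) (h0 : F {0}ᶜ ≠ 0) (hR : 0 < expRadius F)
    (hG : IsMeromorphicExtension F G) {z : ℂ} (hz : z.re < 0) :
    ‖(1 - G z)⁻¹‖ ≤ (1 - ∫ x : ℝ, Real.exp (z.re * x) ∂F)⁻¹ := by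
  have h1 : ∫ x : ℝ, Real.exp (z.re * x) ∂F < 1 := by
    simpa using integral_exp_lt_one hF h0 (neg_pos.2 hz)
  rw [norm_inv]
  refine inv_anti₀ (sub_pos.2 h1) ?_
  have h2 := norm_sub_norm_le (1 : ℂ) (G z)
  rw [norm_one, hG.eq_laplace hR hz.le] at h2
  rw [hG.eq_laplace hR hz.le]
  have h3 := norm_laplace_le (F := F) z
  linarith

theorem integrable_vertical_of_bound (hG : IsMeromorphicExtension F G) {r C D : ℝ} (hr : r ≠ 0)
    {h : ℂ → ℂ} (hh : Measurable h)
    (hC : ∀ θ : ℝ, ‖(1 - G ((r : ℂ) + θ * Complex.I))⁻¹‖ ≤ C)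
    (hD : ∀ θ : ℝ, ‖h ((r : ℂ) + θ * Complex.I)‖ ≤ D * (r ^ 2 + θ ^ 2)⁻¹) :
    Integrable (fun θ : ℝ => h ((r : ℂ) + θ * Complex.I) / (1 - G ((r : ℂ) + θ * Complex.I))) := by
  refine ((integrable_inv_sq_add_sq hr).const_mul (D * C)).mono' ?_ (Eventually.of_forall ?_)
  · exact ((hh.comp (by fun_prop : Measurable fun θ : ℝ => (r : ℂ) + θ * Complex.I)).div
      (measurable_const.sub (measurable_vertical hG r))).aestronglyMeasurable
  · intro θ
    rw [div_eq_mul_inv, norm_mul]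
    have h1 := mul_le_mul (hD θ) (hC θ) (norm_nonneg _) ((norm_nonneg _).trans (hD θ))
    exact h1.trans_eq (by ring)

theorem norm_cexp_div_sq_vertical (x r θ : ℝ) :
    ‖Complex.exp (-x * ((r : ℂ) + θ * Complex.I)) / ((r : ℂ) + θ * Complex.I) ^ 2‖ =
      Real.exp (-(x * r)) * (r ^ 2 + θ ^ 2)⁻¹ := by
  rw [norm_div, norm_pow, norm_sq_vertical, Complex.norm_exp, div_eq_mul_inv]
  simp

theorem integrable_left [IsProbabilityMeasure F] (hF : F (Iio 0) = 0) (h0 : F {0}ᶜ ≠ 0) (hR : 0 < expRadius F)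
    (hG : IsMeromorphicExtension F G) {a : ℝ} (ha : 0 < a) (x : ℝ) :
    Integrable fun θ : ℝ => Complex.exp (-x * (((-a : ℝ) : ℂ) + θ * Complex.I)) /
      (((-a : ℝ) : ℂ) + θ * Complex.I) ^ 2 / (1 - G (((-a : ℝ) : ℂ) + θ * Complex.I)) :=
  integrable_vertical_of_bound hG (neg_ne_zero.2 ha.ne')
    (h := fun z => Complex.exp (-x * z) / z ^ 2) (by fun_prop)
    (fun θ => by
      have := norm_inv_one_sub_le_left hF h0 hR hG
        (z := ((-a : ℝ) : ℂ) + θ * Complex.I) (by simpa using ha)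
      simpa using this)
    (fun θ => (norm_cexp_div_sq_vertical x (-a) θ).le)

theorem integral_left [IsProbabilityMeasure F] (hF : F (Iio 0) = 0) (h0 : F {0}ᶜ ≠ 0) (hR : 0 < expRadius F)
    (hG : IsMeromorphicExtension F G) {a : ℝ} (ha : 0 < a) (x : ℝ) :
    ∫ θ : ℝ, Complex.exp (-x * (((-a : ℝ) : ℂ) + θ * Complex.I)) /
      (((-a : ℝ) : ℂ) + θ * Complex.I) ^ 2 / (1 - G (((-a : ℝ) : ℂ) + θ * Complex.I)) =
        2 * Real.pi * (rampMass F x : ℂ) := by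
  have e1 : ∀ θ : ℝ, Complex.exp (-x * (((-a : ℝ) : ℂ) + θ * Complex.I)) /
      (((-a : ℝ) : ℂ) + θ * Complex.I) ^ 2 / (1 - G (((-a : ℝ) : ℂ) + θ * Complex.I)) =
      ∫ y : ℝ, Complex.exp ((((-a : ℝ) : ℂ) + θ * Complex.I) * ((y - x : ℝ) : ℂ)) /
        (((-a : ℝ) : ℂ) + θ * Complex.I) ^ 2 ∂renewalMeasure F := by
    intro θ
    have hre : (((-a : ℝ) : ℂ) + θ * Complex.I).re < 0 := by simpa using ha
    rw [hG.eq_laplace hR hre.le, div_eq_mul_one_div, ← laplace_renewalMeasure hF h0 hre, laplace,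
      ← integral_const_mul]
    congr 1
    ext y
    rw [div_mul_eq_mul_div, ← Complex.exp_add]
    congr 2
    push_cast
    ring
  simp only [e1]
  rw [integral_integral_swap]
  · simp only [integral_cexp_div_sq ha, neg_sub]
    rw [integral_const_mul, integral_complex_ofReal]
    rfl
  · have h1 : Integrable (fun y : ℝ => Real.exp (a * x) * Real.exp (-a * y)) (renewalMeasure F) :=
      (integrable_exp_renewalMeasure hF h0 ha).const_mul _
    have h2 := integrable_inv_sq_add_sq (neg_ne_zero.2 ha.ne')
    refine (h2.mul_prod h1).mono' ?_ (Eventually.of_forall ?_)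
    · exact (by fun_prop : Measurable (Function.uncurry fun (θ y : ℝ) =>
        Complex.exp ((((-a : ℝ) : ℂ) + θ * Complex.I) * ((y - x : ℝ) : ℂ)) /
          (((-a : ℝ) : ℂ) + θ * Complex.I) ^ 2)).aestronglyMeasurable
    · rintro ⟨θ, y⟩
      simp only [Function.uncurry]
      rw [norm_div, norm_pow, norm_sq_vertical, Complex.norm_exp, div_eq_inv_mul, ← Real.exp_add]
      refine le_of_eq ?_
      congr 2
      simp
      ring

theorem measurable_boxKernel (x p q : ℝ) : Measurable (boxKernel x p q) :=
  Continuous.measurable (continuous_iff_continuousAt.2 fun z =>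
    (boxKernel_analyticAt x p q z).continuousAt)

theorem integral_sub_sub_add {A B C D : ℝ → ℂ} (hA : Integrable A) (hB : Integrable B)
    (hC : Integrable C) (hD : Integrable D) :
    ∫ t, (A t - B t - C t + D t) = (∫ t, A t) - (∫ t, B t) - (∫ t, C t) + ∫ t, D t := by
  have h1 : Integrable fun t => A t - B t := hA.sub hB
  have h2 : Integrable fun t => A t - B t - C t := h1.sub hC
  rw [integral_add h2 hD, integral_sub h1 hC, integral_sub hA hB]

theorem integral_boxKernel_left [IsProbabilityMeasure F] (hF : F (Iio 0) = 0) (h0 : F {0}ᶜ ≠ 0) (hR : 0 < expRadius F)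
    (hG : IsMeromorphicExtension F G) {a : ℝ} (ha : 0 < a) (x p q : ℝ) :
    Integrable (fun θ : ℝ => boxKernel x p q (((-a : ℝ) : ℂ) + θ * Complex.I) /
      (1 - G (((-a : ℝ) : ℂ) + θ * Complex.I))) ∧
    ∫ θ : ℝ, boxKernel x p q (((-a : ℝ) : ℂ) + θ * Complex.I) /
      (1 - G (((-a : ℝ) : ℂ) + θ * Complex.I)) = 2 * Real.pi *
        ((rampMass F x - rampMass F (x + p) - rampMass F (x + q) + rampMass F (x + p + q) : ℝ) :
          ℂ) := by
  have e := fun θ : ℝ => boxKernel_of_ne x p q (vertical_ne_zero (neg_ne_zero.2 ha.ne') θ)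
  have hi := integrable_left hF h0 hR hG ha
  simp only [e, add_div, sub_div]
  refine ⟨(((hi x).sub (hi (x + p))).sub (hi (x + q))).add (hi (x + p + q)), ?_⟩
  rw [integral_sub_sub_add (hi x) (hi (x + p)) (hi (x + q)) (hi (x + p + q)),
    integral_left hF h0 hR hG ha, integral_left hF h0 hR hG ha, integral_left hF h0 hR hG ha,
    integral_left hF h0 hR hG ha]
  push_cast
  ring

theorem nonLatticeSup_bound {r ε : ℝ} (hr : 0 < r)
    (h : nonLatticeSup G r ≤ ENNReal.ofReal ε) (θ : ℝ) :
    G (r + θ * Complex.I) ≠ 1 ∧ ‖(1 - G (r + θ * Complex.I))⁻¹‖ ≤ ε * r := by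
  obtain ⟨h1, h2⟩ := inv_enorm_le_ofReal ((le_iSup (fun θ : ℝ =>
    ‖(r : ℂ) * (1 - G ((r : ℂ) + (θ : ℂ) * Complex.I))‖ₑ⁻¹) θ).trans h)
  have h3 : 1 - G (r + θ * Complex.I) ≠ 0 := right_ne_zero_of_mul h1
  refine ⟨fun h4 => h3 (by rw [h4, sub_self]), ?_⟩
  rw [norm_mul, mul_inv, Complex.norm_real, Real.norm_of_nonneg hr.le, inv_mul_le_iff₀ hr] at h2
  rw [norm_inv]
  linarith

/-- The kernel is at most `4 / |z|²` and `|1 / (1 - G)| ≤ ε r`; the growth in `r` is cancelled by `∫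
(r² + θ²)⁻¹ dθ = π / r`. -/
theorem integral_boxKernel_right (hG : IsMeromorphicExtension F G) {x p q r ε : ℝ} (hr : 0 < r)
    (hx : 0 ≤ x) (hp : 0 ≤ p) (hq : 0 ≤ q)
    (h : nonLatticeSup G r ≤ ENNReal.ofReal ε) :
    Integrable (fun θ : ℝ => boxKernel x p q ((r : ℂ) + θ * Complex.I) /
      (1 - G ((r : ℂ) + θ * Complex.I))) ∧
    ‖∫ θ : ℝ, boxKernel x p q ((r : ℂ) + θ * Complex.I) /
      (1 - G ((r : ℂ) + θ * Complex.I))‖ ≤ 4 * Real.pi * ε := by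
  have hC : ∀ θ : ℝ, ‖(1 - G ((r : ℂ) + θ * Complex.I))⁻¹‖ ≤ ε * r :=
    fun θ => (nonLatticeSup_bound hr h θ).2
  have hD : ∀ θ : ℝ, ‖boxKernel x p q ((r : ℂ) + θ * Complex.I)‖ ≤ 4 * (r ^ 2 + θ ^ 2)⁻¹ := by
    intro θ
    have := norm_boxKernel_le (b := 0) hx hp hq (vertical_ne_zero hr.ne' θ) (by simpa using hr.le)
    rw [norm_sq_vertical] at this
    refine this.trans_eq ?_
    simp only [mul_zero, Real.exp_zero, div_eq_mul_inv]
    ring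
  refine ⟨integrable_vertical_of_bound hG hr.ne' (measurable_boxKernel x p q) hC hD, ?_⟩
  have hb : ∀ θ : ℝ, ‖boxKernel x p q ((r : ℂ) + θ * Complex.I) /
      (1 - G ((r : ℂ) + θ * Complex.I))‖ ≤ 4 * ε * r * (r ^ 2 + θ ^ 2)⁻¹ := by
    intro θ
    rw [div_eq_mul_inv, norm_mul]
    have h1 := mul_le_mul (hD θ) (hC θ) (norm_nonneg _) ((norm_nonneg _).trans (hD θ))
    exact h1.trans_eq (by ring)
  refine (norm_integral_le_of_norm_le ((integrable_inv_sq_add_sq hr.ne').const_mul _)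
    (Eventually.of_forall hb)).trans_eq ?_
  rw [integral_const_mul, integral_inv_sq_add_sq hr.ne', abs_of_pos hr]
  field_simp

/-! ### Bounds in a strip -/

theorem integrable_id_of_expRadius_pos (hF : F (Iio 0) = 0) (hR : 0 < expRadius F) :
    Integrable (fun x : ℝ => x) F := by
  obtain ⟨_, ⟨δ, ⟨-, hδi⟩, rfl⟩, hδ⟩ := lt_sSup_iff.1 hR
  have hδ' : 0 < δ := EReal.coe_pos.1 hδ
  refine (hδi.const_mul (1 / δ)).mono' (by fun_prop) ?_
  filter_upwards [ae_nonneg_of_Iio hF] with x hx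
  rw [Real.norm_of_nonneg hx]
  have := Real.add_one_le_exp (δ * x)
  rw [div_mul_eq_mul_div, one_mul, le_div_iff₀ hδ']
  linarith

theorem norm_laplace_sub_le [IsProbabilityMeasure F] (hF : F (Iio 0) = 0) (hR : 0 < expRadius F) {r : ℝ} (hr : r ≤ 0)
    (θ : ℝ) : ‖laplace F ((r : ℂ) + θ * Complex.I) - laplace F (((0 : ℝ) : ℂ) + θ * Complex.I)‖ ≤
      -r * ∫ x : ℝ, x ∂F := by
  have hae := ae_nonneg_of_Iio hF
  rw [laplace, laplace, ← integral_sub (integrable_cexp_mul hae (by simpa using hr))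
    (integrable_cexp_mul hae (by simp)), ← integral_const_mul]
  refine norm_integral_le_of_norm_le ((integrable_id_of_expRadius_pos hF hR).const_mul _) ?_
  filter_upwards [hae] with x hx
  have e : Complex.exp (((r : ℂ) + θ * Complex.I) * x) -
      Complex.exp ((((0 : ℝ) : ℂ) + θ * Complex.I) * x) =
      ((Real.exp (r * x) - 1 : ℝ) : ℂ) * Complex.exp (((θ * x : ℝ) : ℂ) * Complex.I) := by
    push_cast
    rw [sub_mul, ← Complex.exp_add, one_mul]
    congr 1
    · congr 1; ring
    · congr 1; ring
  rw [e, norm_mul, Complex.norm_exp_ofReal_mul_I, mul_one, Complex.norm_real, Real.norm_eq_abs,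
    abs_of_nonpos]
  · have := Real.add_one_le_exp (r * x)
    linarith
  · rw [sub_nonpos, Real.exp_le_one_iff]
    exact mul_nonpos_of_nonpos_of_nonneg hr hx

theorem BoundedAtVerticalInfinity.exists_bound {R₀ : ℝ} (h : BoundedAtVerticalInfinity G R₀) :
    ∃ C T : ℝ, 0 < C ∧ ∀ r θ : ℝ, r ∈ Icc 0 R₀ → T ≤ |θ| →
      ‖(1 - G ((r : ℂ) + θ * Complex.I))⁻¹‖ ≤ C ∧ 1 - G ((r : ℂ) + θ * Complex.I) ≠ 0 := by
  obtain ⟨c, hc1, hc2⟩ := exists_between h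
  have hev := eventually_lt_of_limsup_lt hc1
  rw [eventually_sup, eventually_atBot, eventually_atTop] at hev
  obtain ⟨⟨T₁, hT₁⟩, ⟨T₂, hT₂⟩⟩ := hev
  refine ⟨c.toReal + 1, max (-T₁) T₂, by positivity, fun r θ hr hθ => ?_⟩
  have hθ' : (⨆ r ∈ Icc (0 : ℝ) R₀, ‖1 - G ((r : ℂ) + (θ : ℂ) * Complex.I)‖ₑ⁻¹) < c := by
    rcases le_total 0 θ with hs | hs
    · rw [abs_of_nonneg hs] at hθ
      exact hT₂ θ ((le_max_right _ _).trans hθ)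
    · rw [abs_of_nonpos hs] at hθ
      have := (le_max_left (-T₁) T₂).trans hθ
      exact hT₁ θ (by linarith)
  have hle := (le_iSup₂ (f := fun r (_ : r ∈ Icc (0 : ℝ) R₀) =>
    ‖1 - G ((r : ℂ) + (θ : ℂ) * Complex.I)‖ₑ⁻¹) r hr).trans hθ'.le
  rw [← ENNReal.ofReal_toReal hc2.ne] at hle
  obtain ⟨h1, h2⟩ := inv_enorm_le_ofReal hle
  rw [norm_inv]
  exact ⟨by linarith, h1⟩

/-- The assumption controls `1 / (1 - G)` only for `Re z ≥ 0`, while the starting line lies to the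
left. On `Re z ≤ 0` horizontal steps change `G` by at most the step length times the mean of `F`, so
a short step left from the imaginary axis keeps half of the lower bound for `|1 - G|`. -/
theorem exists_left_strip_bound [IsProbabilityMeasure F] (hF : F (Iio 0) = 0) (hR : 0 < expRadius F)
    (hG : IsMeromorphicExtension F G) (hB : ∀ R₀ : ℝ, 0 < R₀ → BoundedAtVerticalInfinity G R₀) :
    ∃ a : ℝ, 0 < a ∧ ∀ R₀ : ℝ, 0 < R₀ → ∃ C T : ℝ, 0 < C ∧ ∀ r θ : ℝ, r ∈ Icc (-a) R₀ → T ≤ |θ| →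
      ‖(1 - G ((r : ℂ) + θ * Complex.I))⁻¹‖ ≤ C := by
  obtain ⟨C₁, T₁, hC₁, h₁⟩ := (hB 1 one_pos).exists_bound
  set μ : ℝ := ∫ x : ℝ, x ∂F with hμ
  have hμ0 : 0 ≤ μ := integral_nonneg_of_ae (ae_nonneg_of_Iio hF)
  -- The step length makes the change of `G` at most `1 / (2 C₁)`, half of `1 / C₁`; `μ + 1` avoids
  -- dividing by a zero mean. It does not depend on `R₀`.
  refine ⟨1 / (2 * C₁ * (μ + 1)), by positivity, fun R₀ hR₀ => ?_⟩
  obtain ⟨C₂, T₂, hC₂, h₂⟩ := (hB R₀ hR₀).exists_bound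
  refine ⟨max (2 * C₁) C₂, max T₁ T₂, lt_max_of_lt_right hC₂, fun r θ hr hθ => ?_⟩
  rcases le_or_gt 0 r with hr0 | hr0
  · exact ((h₂ r θ ⟨hr0, hr.2⟩ ((le_max_right _ _).trans hθ)).1).trans (le_max_right _ _)
  · refine le_trans ?_ (le_max_left _ _)
    obtain ⟨h3, h4⟩ := h₁ 0 θ ⟨le_rfl, zero_le_one⟩ ((le_max_left _ _).trans hθ)
    have h5 := norm_laplace_sub_le hF hR hr0.le θ
    rw [← hG.eq_laplace hR (by simpa using hr0.le), ← hG.eq_laplace hR (by simp), ← hμ] at h5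
    have h6 : 1 / C₁ ≤ ‖1 - G (((0 : ℝ) : ℂ) + θ * Complex.I)‖ := by
      rw [norm_inv, inv_le_comm₀ (norm_pos_iff.2 h4) hC₁] at h3
      rwa [one_div]
    have h7 : -r * μ ≤ 1 / (2 * C₁) := by
      have h8 : -r ≤ 1 / (2 * C₁ * (μ + 1)) := by linarith [hr.1]
      calc -r * μ ≤ 1 / (2 * C₁ * (μ + 1)) * (μ + 1) := by gcongr; linarith
        _ = 1 / (2 * C₁) := by field_simp
    have h9 : ‖1 - G (((0 : ℝ) : ℂ) + θ * Complex.I)‖ ≤ ‖1 - G ((r : ℂ) + θ * Complex.I)‖ +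
        ‖G ((r : ℂ) + θ * Complex.I) - G (((0 : ℝ) : ℂ) + θ * Complex.I)‖ := by
      refine (norm_add_le _ _).trans_eq' ?_
      congr 1
      ring
    have h10 : 1 / C₁ = 1 / (2 * C₁) + 1 / (2 * C₁) := by field_simp; norm_num
    have h11 : (2 * C₁)⁻¹ ≤ ‖1 - G ((r : ℂ) + θ * Complex.I)‖ := by
      rw [← one_div]; linarith
    rw [norm_inv]
    exact inv_le_of_inv_le₀ (by positivity) h11

/-! ### Shifting the line of integration -/

/-- Since the points `w i` are real, `|x + it - w i| ≥ |t|`, so the added fractions decay as well.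
-/
theorem tendsto_integral_horizontal {f : ℂ → ℂ} {a b B T₀ : ℝ} {ι : Type*} (S : Finset ι)
    (c : ι → ℂ) (w : ι → ℂ) (hw : ∀ i ∈ S, (w i).im = 0) (hab : a ≤ b)
    (hf : ∀ x t : ℝ, x ∈ Icc a b → T₀ ≤ |t| → ‖f (x + t * Complex.I)‖ ≤ B / t ^ 2)
    {l : Filter ℝ} (hl : Tendsto (fun t : ℝ => |t|) l atTop) :
    Tendsto (fun t : ℝ => ∫ x in a..b, (f (x + t * Complex.I) +
      ∑ i ∈ S, c i * ((x : ℂ) + t * Complex.I - w i)⁻¹)) l (𝓝 0) := by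
  have hlim : Tendsto (fun t : ℝ => (B / |t| ^ 2 + (∑ i ∈ S, ‖c i‖) / |t|) * |b - a|) l (𝓝 0) := by
    have h1 : Tendsto (fun t : ℝ => B / |t| ^ 2) l (𝓝 0) :=
      tendsto_const_nhds.div_atTop ((tendsto_pow_atTop two_ne_zero).comp hl)
    have h2 : Tendsto (fun t : ℝ => (∑ i ∈ S, ‖c i‖) / |t|) l (𝓝 0) :=
      tendsto_const_nhds.div_atTop hl
    simpa using (h1.add h2).mul_const |b - a|
  refine squeeze_zero_norm' ?_ hlim
  filter_upwards [hl.eventually_ge_atTop T₀, hl.eventually_gt_atTop 0] with t ht ht0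
  refine intervalIntegral.norm_integral_le_of_norm_le_const fun x hx => ?_
  rw [uIoc_of_le hab] at hx
  refine (norm_add_le _ _).trans (add_le_add ?_ ?_)
  · rw [sq_abs]
    exact hf x t ⟨hx.1.le, hx.2⟩ ht
  · refine (norm_sum_le _ _).trans ?_
    rw [Finset.sum_div]
    refine Finset.sum_le_sum fun i hi => ?_
    rw [norm_mul, norm_inv, div_eq_mul_inv]
    gcongr
    have := Complex.abs_im_le_norm ((x : ℂ) + t * Complex.I - w i)
    simpa [hw i hi] using this

theorem tendsto_integral_vertical {f : ℂ → ℂ} {r : ℝ} {ι : Type*} (S : Finset ι)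
    (c : ι → ℂ) (w : ι → ℂ) (hw : ∀ i ∈ S, (w i).im = 0 ∧ r ≠ (w i).re)
    (hf : Integrable fun θ : ℝ => f (r + θ * Complex.I)) :
    Tendsto (fun T : ℝ => ∫ y in -T..T, (f (r + y * Complex.I) +
      ∑ i ∈ S, c i * ((r : ℂ) + y * Complex.I - w i)⁻¹)) atTop
      (𝓝 ((∫ θ : ℝ, f (r + θ * Complex.I)) + ∑ i ∈ S,
        c i * (((r - (w i).re) * (Real.pi / |r - (w i).re|) : ℝ) : ℂ))) := by
  have e : ∀ i ∈ S, ∀ y : ℝ, (r : ℂ) + y * Complex.I - w i =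
      ((r - (w i).re : ℝ) : ℂ) + y * Complex.I := by
    intro i hi y
    apply Complex.ext <;> simp [(hw i hi).1]
  have hint : ∀ i ∈ S, ∀ T : ℝ, IntervalIntegrable
      (fun y : ℝ => c i * ((r : ℂ) + y * Complex.I - w i)⁻¹) volume (-T) T := by
    intro i hi T
    refine Continuous.intervalIntegrable ?_ _ _
    simp only [e i hi]
    exact continuous_const.mul (Continuous.inv₀ (by fun_prop)
      fun y => vertical_ne_zero (sub_ne_zero.2 (hw i hi).2) y)
  have hsplit : ∀ T : ℝ, ∫ y in -T..T, (f (r + y * Complex.I) +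
      ∑ i ∈ S, c i * ((r : ℂ) + y * Complex.I - w i)⁻¹) =
      (∫ y in -T..T, f (r + y * Complex.I)) +
        ∑ i ∈ S, c i * ∫ y in -T..T, (((r - (w i).re : ℝ) : ℂ) + y * Complex.I)⁻¹ := by
    intro T
    rw [intervalIntegral.integral_add hf.intervalIntegrable
      (by simpa [Finset.sum_fn] using IntervalIntegrable.sum S fun i hi => hint i hi T),
      intervalIntegral.integral_finsetSum fun i hi => hint i hi T]
    congr 1
    refine Finset.sum_congr rfl fun i hi => ?_
    rw [intervalIntegral.integral_const_mul]
    simp only [e i hi]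
  simp only [hsplit]
  exact (intervalIntegral_tendsto_integral hf tendsto_neg_atTop_atBot tendsto_id).add
    (tendsto_finsetSum _ fun i hi =>
      (tendsto_integral_vertical_inv (sub_ne_zero.2 (hw i hi).2)).const_mul _)

theorem mul_pi_div_abs_of_pos {s : ℝ} (hs : 0 < s) : s * (Real.pi / |s|) = Real.pi := by
  rw [abs_of_pos hs]; field_simp

theorem mul_pi_div_abs_of_neg {s : ℝ} (hs : s < 0) : s * (Real.pi / |s|) = -Real.pi := by
  have := hs.ne
  rw [abs_of_neg hs, div_neg, mul_neg, mul_div_cancel₀ _ this]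

/-- The residue theorem for the strip `a ≤ Re z ≤ b`, all poles being real and simple. -/
theorem integral_vertical_sub_eq_sum {f : ℂ → ℂ} (hf : Meromorphic f) {a b B T₀ : ℝ}
    (hab : a ≤ b) (S : Finset ℂ) (c : ℂ → ℂ)
    (hS : ∀ w ∈ S, w.im = 0 ∧ a < w.re ∧ w.re < b)
    (hpole : ∀ w ∈ S, ∃ ψ, AnalyticAt ℂ ψ w ∧
      ∀ᶠ z in 𝓝[≠] w, f z = -c w * (z - w)⁻¹ + ψ z)
    (hord : ∀ z : ℂ, a ≤ z.re → z.re ≤ b → z ∉ S → 0 ≤ meromorphicOrderAt f z)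
    (hbound : ∀ x t : ℝ, x ∈ Icc a b → T₀ ≤ |t| → ‖f (x + t * Complex.I)‖ ≤ B / t ^ 2)
    (ha : Integrable fun θ : ℝ => f (a + θ * Complex.I))
    (hb : Integrable fun θ : ℝ => f (b + θ * Complex.I)) :
    (∫ θ : ℝ, f (a + θ * Complex.I)) - (∫ θ : ℝ, f (b + θ * Complex.I)) =
      2 * Real.pi * ∑ w ∈ S, c w := by
  classical
  -- Adding the fractions cancels all poles, so Cauchy's theorem applies to `g` on rectangles of
  -- growing height. In the limit each fraction contributes `π c w` on the right line and `-π c w`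
  -- on the left one, hence `2π c w` in all.
  set g : ℂ → ℂ := fun z => f z + ∑ w ∈ S, c w * (z - w)⁻¹ with hg
  have hinv : ∀ z w : ℂ, MeromorphicAt (fun z => c w * (z - w)⁻¹) z := fun z w =>
    analyticAt_const.meromorphicAt.mul
      ((analyticAt_id.meromorphicAt.sub analyticAt_const.meromorphicAt).inv)
  have hinva : ∀ z w : ℂ, z ≠ w → AnalyticAt ℂ (fun z => c w * (z - w)⁻¹) z := fun z w h =>
    analyticAt_const.mul ((analyticAt_id.sub analyticAt_const).inv (sub_ne_zero.2 h))
  have hgm : Meromorphic g := fun z => (hf z).add (MeromorphicAt.fun_sum fun w _ => hinv z w)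
  have hgo : ∀ z : ℂ, a ≤ z.re → z.re ≤ b → 0 ≤ meromorphicOrderAt g z := by
    intro z h1 h2
    by_cases hz : z ∈ S
    · obtain ⟨ψ, hψ, hψe⟩ := hpole z hz
      have han : AnalyticAt ℂ (fun y => ψ y + ∑ w ∈ S.erase z, c w * (y - w)⁻¹) z :=
        hψ.add (Finset.analyticAt_fun_sum _ fun w hw => hinva z w (Finset.ne_of_mem_erase hw).symm)
      have hev : g =ᶠ[𝓝[≠] z] fun y => ψ y + ∑ w ∈ S.erase z, c w * (y - w)⁻¹ := by
        filter_upwards [hψe] with y hy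
        simp only [hg]
        rw [← Finset.add_sum_erase S _ hz, hy]
        ring
      rw [meromorphicOrderAt_congr hev]
      exact han.meromorphicOrderAt_nonneg
    · have han : AnalyticAt ℂ (fun y => ∑ w ∈ S, c w * (y - w)⁻¹) z :=
        Finset.analyticAt_fun_sum _ fun w hw => hinva z w (by rintro rfl; exact hz hw)
      exact (le_min (hord z h1 h2 hz) han.meromorphicOrderAt_nonneg).trans
        (meromorphicOrderAt_add (hf z) han.meromorphicAt)
  have hrect : ∀ᶠ T : ℝ in atTop,
      (∫ x : ℝ in a..b, g (x + ((-T : ℝ) : ℂ) * Complex.I)) -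
        (∫ x : ℝ in a..b, g (x + T * Complex.I)) +
      Complex.I * (∫ y : ℝ in -T..T, g (b + y * Complex.I)) -
      Complex.I * (∫ y : ℝ in -T..T, g (a + y * Complex.I)) = 0 := by
    filter_upwards [eventually_ge_atTop 0] with T hT
    exact integral_boundary_rect_eq_zero_of_meromorphic hgm hab (by linarith)
      fun z h1 h2 _ _ => hgo z h1 h2
  have him : ∀ w ∈ S, w.im = 0 := fun w hw => (hS w hw).1
  have t1 := tendsto_integral_horizontal S c id him hab hbound
    (tendsto_abs_atBot_atTop (G := ℝ))
  have t2 := tendsto_integral_horizontal S c id him hab hbound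
    (tendsto_abs_atTop_atTop (G := ℝ))
  have t3 := tendsto_integral_vertical S c id
    (fun w hw => ⟨(hS w hw).1, (hS w hw).2.2.ne'⟩) hb
  have t4 := tendsto_integral_vertical S c id
    (fun w hw => ⟨(hS w hw).1, (hS w hw).2.1.ne⟩) ha
  have t5 := (((t1.comp tendsto_neg_atTop_atBot).sub t2).add (t3.const_mul Complex.I)).sub
    (t4.const_mul Complex.I)
  have hz := tendsto_nhds_unique_of_eventuallyEq t5 tendsto_const_nhds hrect
  have s3 : ∑ w ∈ S, c (id w) * (((b - (id w).re) * (Real.pi / |b - (id w).re|) : ℝ) : ℂ) =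
      Real.pi * ∑ w ∈ S, c w := by
    rw [Finset.mul_sum]
    refine Finset.sum_congr rfl fun w hw => ?_
    rw [id, mul_pi_div_abs_of_pos (sub_pos.2 (hS w hw).2.2), mul_comm]
  have s4 : ∑ w ∈ S, c (id w) * (((a - (id w).re) * (Real.pi / |a - (id w).re|) : ℝ) : ℂ) =
      -(Real.pi * ∑ w ∈ S, c w) := by
    rw [Finset.mul_sum, ← Finset.sum_neg_distrib]
    refine Finset.sum_congr rfl fun w hw => ?_
    rw [id, mul_pi_div_abs_of_neg (sub_neg.2 (hS w hw).2.1)]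
    push_cast
    ring
  simp only [id] at s3 s4 hz
  rw [s3, s4] at hz
  have hz' := congrArg (fun z => Complex.I * z) hz
  simp only [mul_zero] at hz'
  linear_combination hz' - (((∫ θ : ℝ, f (b + θ * Complex.I)) -
    (∫ θ : ℝ, f (a + θ * Complex.I))) + 2 * Real.pi * ∑ w ∈ S, c w) * Complex.I_sq

end NonLattice

/-! ### The non-lattice case: from root sums to the density -/

section NonLattice

variable {F : Measure ℝ} {G : ℂ → ℂ}

theorem compl_singleton_ne_zero_of_not_isLattice (h : ¬ IsLattice F) : F {0}ᶜ ≠ 0 := by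
  intro h0
  refine h ⟨1, one_pos, measure_mono_null (compl_subset_compl.2 ?_) h0⟩
  rintro _ rfl
  exact ⟨0, by simp⟩

/-- The second difference of `rampMass`, the mass of a hat function. -/
noncomputable def hatMass (F : Measure ℝ) (x p q : ℝ) : ℝ :=
  rampMass F x - rampMass F (x + p) - rampMass F (x + q) + rampMass F (x + p + q)

/-- The strip formula between `-a` and `r`; the bound is `4πε / (2π)`. The double zero of `z²` is
removable in the kernel, so `0` enters only as a root of `G = 1`. -/
theorem norm_sum_boxKernel_sub_le [IsProbabilityMeasure F] (hF : F (Iio 0) = 0)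
    (h0 : F {0}ᶜ ≠ 0) (hR : 0 < expRadius F) (hG : IsMeromorphicExtension F G)
    (hB : ∀ R₀ : ℝ, 0 < R₀ → BoundedAtVerticalInfinity G R₀)
    (hroots : ∀ w ∈ roots G, w.im = 0 ∧ deriv G w ≠ 0) {x p q r ε : ℝ} (hx : 0 ≤ x)
    (hp : 0 ≤ p) (hq : 0 ≤ q) (hr : 0 < r) (hε : nonLatticeSup G r ≤ ENNReal.ofReal ε)
    (S : Finset ℂ) (hS : ∀ w, w ∈ S ↔ w ∈ roots G ∧ w.re < r) :
    ‖∑ w ∈ S, boxKernel x p q w / deriv G w - (hatMass F x p q : ℂ)‖ ≤ 2 * ε := by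
  obtain ⟨a, ha, hstrip⟩ := exists_left_strip_bound hF hR hG hB
  obtain ⟨C, T, hC, hCT⟩ := hstrip r hr
  obtain ⟨hli, hlv⟩ := integral_boxKernel_left hF h0 hR hG ha x p q
  obtain ⟨hri, hrv⟩ := integral_boxKernel_right hG hr hx hp hq hε
  set D : ℝ := Real.exp (x * a) * ((1 + Real.exp (p * a)) * (1 + Real.exp (q * a))) with hD
  have hD0 : 0 ≤ D := by positivity
  have key := integral_vertical_sub_eq_sum (f := fun z => boxKernel x p q z / (1 - G z))
    (hG.meromorphic_div (boxKernel_analyticAt x p q)) (a := -a) (b := r) (B := D * C)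
    (T₀ := max T 1) (by linarith) S (fun w => boxKernel x p q w / deriv G w)
    (fun w hw => by
      obtain ⟨h1, h2⟩ := (hS w).1 hw
      have := hG.re_nonneg_of_eq_one hF h0 hR h1
      exact ⟨(hroots w h1).1, by linarith, h2⟩)
    (fun w hw => hG.hasResidue_div (boxKernel_analyticAt x p q w) ((hS w).1 hw).1
      (hroots w ((hS w).1 hw).1).2)
    (fun z h1 h2 h3 => by
      refine hG.order_div_nonneg (boxKernel_analyticAt x p q z) fun hz => ?_
      rcases h2.lt_or_eq with h4 | h4
      · exact h3 ((hS z).2 ⟨hz, h4⟩)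
      -- All roots are real, so one with real part `r` would sit at `θ = 0`.
      · refine (nonLatticeSup_bound hr hε 0).1 ?_
        have : (r : ℂ) + ((0 : ℝ) : ℂ) * Complex.I = z := by
          apply Complex.ext <;> simp [h4, (hroots z hz).1]
        rw [this, hz])
    (fun y t hy ht => by
      have ht0 : 0 < |t| := by linarith [(le_max_right T 1).trans ht]
      have ht1 : t ≠ 0 := abs_pos.1 ht0
      have hz : (y : ℂ) + t * Complex.I ≠ 0 := fun h => ht1 (by
        simpa using congrArg Complex.im h)
      have h1 := norm_boxKernel_le (b := a) hx hp hq hz (by simpa using hy.1)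
      rw [norm_sq_vertical, ← hD] at h1
      have h2 := hCT y t hy ((le_max_left _ _).trans ht)
      rw [div_eq_mul_inv, norm_mul]
      calc _ ≤ D / (y ^ 2 + t ^ 2) * C := by gcongr
        _ ≤ D / t ^ 2 * C := by
          gcongr
          nlinarith [sq_nonneg y]
        _ = D * C / t ^ 2 := by ring)
    hli hri
  rw [hlv] at key
  have hpi : (2 * Real.pi : ℂ) ≠ 0 := by simp [Real.pi_ne_zero]
  have e : ∑ w ∈ S, boxKernel x p q w / deriv G w - (hatMass F x p q : ℂ) =
      -((2 * Real.pi : ℂ)⁻¹ * ∫ θ : ℝ, boxKernel x p q ((r : ℂ) + θ * Complex.I) /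
        (1 - G ((r : ℂ) + θ * Complex.I))) := by
    have := congrArg (fun z => (2 * Real.pi : ℂ)⁻¹ * z) key
    simp only [mul_sub, inv_mul_cancel_left₀ hpi] at this
    rw [hatMass, ← this]
    ring
  have hn : ‖(2 * Real.pi : ℂ)⁻¹‖ = (2 * Real.pi)⁻¹ := by simp [abs_of_pos Real.pi_pos]
  rw [e, norm_neg, norm_mul, hn]
  have hpi0 := Real.pi_pos
  calc _ ≤ (2 * Real.pi)⁻¹ * (4 * Real.pi * ε) := by gcongr
    _ = 2 * ε := by field_simp; norm_num

/-- The factor `1 / w` is traded for a smaller abscissa: `e^{-δw} ≤ 1 / (δw)` with `δ = (x - x₀) /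
2`, and `x - δ` still exceeds `x₀`. Adding the root `0` changes a single term. -/
theorem summable_norm_cexp_div_deriv [IsProbabilityMeasure F] (hF : F (Iio 0) = 0)
    (h0 : F {0}ᶜ ≠ 0) (hR : 0 < expRadius F) (hG : IsMeromorphicExtension F G)
    (hroots : ∀ w ∈ roots G, w.im = 0 ∧ deriv G w ≠ 0) {x₀ : ℝ}
    (hsum : ∀ x : ℝ, x₀ < x → Summable fun w : {w : ℂ // w ∈ roots G ∧ w ≠ 0} =>
        ‖Complex.exp (-(x : ℂ) * w) / ((w : ℂ) * deriv G w)‖) {x : ℝ} (hx : x₀ < x) :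
    Summable fun w : roots G => ‖Complex.exp (-(x : ℂ) * w) / deriv G w‖ := by
  have hd : 0 < (x - x₀) / 2 := by linarith
  have h1 := (hsum (x - (x - x₀) / 2) (by linarith)).mul_left ((x - x₀) / 2)⁻¹
  have h2 : Summable fun w : {w : ℂ // w ∈ roots G ∧ w ≠ 0} =>
      ‖Complex.exp (-(x : ℂ) * w) / deriv G w‖ := by
    refine h1.of_nonneg_of_le (fun _ => norm_nonneg _) ?_
    rintro ⟨w, hw, hw0⟩
    have hre := hG.re_nonneg_of_eq_one hF h0 hR hw
    have hwn : ‖w‖ = w.re := by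
      have : w = (w.re : ℂ) := Complex.ext rfl (by simp [(hroots w hw).1])
      rw [this, Complex.norm_real, Real.norm_of_nonneg hre, Complex.ofReal_re]
    have hpos : 0 < ‖w‖ := norm_pos_iff.2 hw0
    simp only
    rw [norm_div, norm_div, norm_mul, Complex.norm_exp, Complex.norm_exp]
    have e1 : (-(x : ℂ) * w).re = -((x - (x - x₀) / 2) * w.re) + -((x - x₀) / 2 * w.re) := by
      simp; ring
    have e2 : (-((x - (x - x₀) / 2 : ℝ) : ℂ) * w).re = -((x - (x - x₀) / 2) * w.re) := by
      simp; ring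
    rw [e1, e2, Real.exp_add]
    have h3 : Real.exp (-((x - x₀) / 2 * w.re)) ≤ ((x - x₀) / 2)⁻¹ * ‖w‖⁻¹ := by
      rw [Real.exp_neg, ← mul_inv, hwn]
      rw [hwn] at hpos
      refine inv_anti₀ (by positivity) ?_
      linarith [Real.add_one_le_exp ((x - x₀) / 2 * w.re)]
    calc _ ≤ Real.exp (-((x - (x - x₀) / 2) * w.re)) * (((x - x₀) / 2)⁻¹ * ‖w‖⁻¹) /
          ‖deriv G w‖ := by gcongr
      _ = _ := by
        rw [div_eq_mul_inv, div_eq_mul_inv, mul_inv]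
        ring
  have h3 := (summable_subtype_iff_indicator (s := {w : ℂ | w ∈ roots G ∧ w ≠ 0})
    (f := fun w : ℂ => ‖Complex.exp (-(x : ℂ) * w) / deriv G w‖)).1 h2
  refine (summable_subtype_iff_indicator (s := roots G)
    (f := fun w : ℂ => ‖Complex.exp (-(x : ℂ) * w) / deriv G w‖)).2 (h3.congr_cofinite ?_)
  have : ({0} : Set ℂ)ᶜ ∈ cofinite := (finite_singleton _).compl_mem_cofinite
  filter_upwards [this] with w hw
  have hw' : w ≠ 0 := hw
  by_cases hr : w ∈ roots G
  · rw [indicator_of_mem hr, indicator_of_mem (show w ∈ {w | w ∈ roots G ∧ w ≠ 0} from ⟨hr, hw'⟩)]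
  · rw [indicator_of_notMem hr, indicator_of_notMem fun h => hr h.1]

theorem norm_boxKernel_div_le [IsProbabilityMeasure F] (hF : F (Iio 0) = 0)
    (h0 : F {0}ᶜ ≠ 0) (hR : 0 < expRadius F) (hG : IsMeromorphicExtension F G) {x p q : ℝ}
    (hp : 0 ≤ p) (hq : 0 ≤ q) (w : roots G) :
    ‖boxKernel x p q w / deriv G w‖ ≤ p * q * ‖Complex.exp (-(x : ℂ) * w) / deriv G w‖ := by
  have hre := hG.re_nonneg_of_eq_one hF h0 hR w.2
  rw [boxKernel, norm_div, norm_mul, norm_mul, norm_div]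
  calc _ ≤ ‖Complex.exp (-(x : ℂ) * w)‖ * (p * q) / ‖deriv G w‖ := by
        gcongr
        · exact norm_expQuot_le hp hre
        · exact norm_expQuot_le hq hre
    _ = _ := by ring

/-- Absolute convergence makes the order of summation irrelevant, so the half-plane sums along good
abscissae tend to the unordered sum. -/
theorem hatMass_eq_tsum [IsProbabilityMeasure F] (hF : F (Iio 0) = 0)
    (h0 : F {0}ᶜ ≠ 0) (hR : 0 < expRadius F) (hG : IsMeromorphicExtension F G)
    (hB : ∀ R₀ : ℝ, 0 < R₀ → BoundedAtVerticalInfinity G R₀)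
    (hroots : ∀ w ∈ roots G, w.im = 0 ∧ deriv G w ≠ 0)
    (hlim : liminf (nonLatticeSup G) atTop = 0) {x p q : ℝ} (hx : 0 ≤ x)
    (hs : Summable fun w : roots G => ‖Complex.exp (-(x : ℂ) * w) / deriv G w‖)
    (hp : 0 ≤ p) (hq : 0 ≤ q) :
    (hatMass F x p q : ℂ) = ∑' w : roots G, boxKernel x p q w / deriv G w := by
  have hsum : Summable fun w : roots G => boxKernel x p q w / deriv G w :=
    Summable.of_norm_bounded (hs.mul_left (p * q))
      fun w => norm_boxKernel_div_le hF h0 hR hG hp hq w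
  obtain ⟨r, hr, hl⟩ := exists_seq_of_liminf_eq_zero hlim
  have hfin : ∀ n, {w : roots G | (w : ℂ).re < r n}.Finite := fun n =>
    Set.Finite.of_finite_image (f := Subtype.val)
      ((hG.finite_roots_inter hF h0 hR (r n) 0).subset (by
        rintro _ ⟨w, hw, rfl⟩
        exact ⟨w.2, le_of_lt hw, by simp [(hroots w w.2).1]⟩)) Subtype.val_injective.injOn
  have hSt : Tendsto (fun n => (hfin n).toFinset) atTop atTop := by
    rw [tendsto_atTop]
    intro b
    have : ∀ᶠ n in atTop, ∀ w ∈ b, (w : ℂ).re < r n :=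
      (Filter.eventually_all_finset b).2 fun w _ => hr.eventually_gt_atTop _
    filter_upwards [this] with n hn w hw
    simpa using hn w hw
  refine tendsto_nhds_unique ?_ (hsum.hasSum.comp hSt)
  rw [Metric.tendsto_nhds]
  intro ε hε
  have hε4 : 0 < ε / 4 := by linarith
  filter_upwards [hr.eventually_gt_atTop 0,
    hl.eventually (gt_mem_nhds (ENNReal.ofReal_pos.2 hε4))] with n h1 h2
  have h3 := norm_sum_boxKernel_sub_le hF h0 hR hG hB hroots hx hp hq h1 h2.le
    ((hfin n).toFinset.map (Function.Embedding.subtype _)) (fun w => by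
      simp only [Finset.mem_map, Set.Finite.mem_toFinset, Function.Embedding.subtype_apply]
      constructor
      · rintro ⟨v, hv, rfl⟩
        exact ⟨v.2, hv⟩
      · rintro ⟨h1, h2⟩
        exact ⟨⟨w, h1⟩, h2, rfl⟩)
  rw [Finset.sum_map] at h3
  rw [dist_eq_norm]
  refine lt_of_le_of_lt h3 (by linarith)

/-! ### Difference quotients -/

theorem integrable_ramp_renewalMeasure [IsProbabilityMeasure F] (hF : F (Iio 0) = 0)
    (h0 : F {0}ᶜ ≠ 0) (x : ℝ) : Integrable (fun y => max (x - y) 0) (renewalMeasure F) := by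
  have h1 : Integrable ((Iic x).indicator fun _ => |x|) (renewalMeasure F) :=
    (integrable_indicator_iff measurableSet_Iic).2
      (integrableOn_const (renewalMeasure_Iic_lt_top hF h0 x).ne)
  refine h1.mono' (by fun_prop) ?_
  filter_upwards [ae_renewalMeasure_nonneg hF] with y hy
  rw [Real.norm_of_nonneg (le_max_right _ _)]
  by_cases hyx : y ≤ x
  · rw [indicator_of_mem (mem_Iic.2 hyx)]
    exact max_le (by linarith [le_abs_self x]) (abs_nonneg x)
  · rw [indicator_of_notMem (by simpa using hyx), max_eq_right (by linarith)]

/-- The right derivative of `(x - y)⁺` in `x` is the indicator of `y ≤ x`, atom at `x` included; the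
quotients are dominated by the indicator of `(-∞, x + 1]`, which has finite mass. -/
theorem tendsto_rampMass_slope [IsProbabilityMeasure F] (hF : F (Iio 0) = 0)
    (h0 : F {0}ᶜ ≠ 0) (x : ℝ) :
    Tendsto (fun q : ℝ => (rampMass F (x + q) - rampMass F x) / q) (𝓝[>] 0)
      (𝓝 ((renewalMeasure F).real (Iic x))) := by
  have e1 : ∀ q : ℝ, (rampMass F (x + q) - rampMass F x) / q =
      ∫ y, (max (x + q - y) 0 - max (x - y) 0) / q ∂renewalMeasure F := by
    intro q
    rw [integral_div, integral_sub (integrable_ramp_renewalMeasure hF h0 _)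
      (integrable_ramp_renewalMeasure hF h0 _)]
    rfl
  simp only [e1]
  rw [← integral_indicator_one measurableSet_Iic]
  refine tendsto_integral_filter_of_dominated_convergence
    ((Iic (x + 1)).indicator fun _ => (1 : ℝ)) ?_ ?_ ?_ ?_
  · exact Eventually.of_forall fun q => by fun_prop
  · filter_upwards [Ioo_mem_nhdsGT (zero_lt_one' ℝ)] with q hq
    refine Eventually.of_forall fun y => ?_
    have h1 : max (x - y) 0 ≤ max (x + q - y) 0 := max_le_max (by linarith [hq.1]) le_rfl
    have h2 : max (x + q - y) 0 ≤ max (x - y) 0 + q :=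
      max_le (by linarith [le_max_left (x - y) 0])
        (by linarith [le_max_right (x - y) 0, hq.1])
    rw [Real.norm_of_nonneg (div_nonneg (by linarith) hq.1.le)]
    by_cases hy : y ≤ x + 1
    · rw [indicator_of_mem (mem_Iic.2 hy), div_le_one hq.1]
      linarith
    · rw [indicator_of_notMem (by simpa using hy), max_eq_right (by linarith [hq.2]),
        max_eq_right (by linarith)]
      simp
  · exact (integrable_indicator_iff measurableSet_Iic).2
      (integrableOn_const (renewalMeasure_Iic_lt_top hF h0 (x + 1)).ne)
  · refine Eventually.of_forall fun y => ?_
    refine tendsto_const_nhds.congr' ?_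
    by_cases hy : y ≤ x
    · filter_upwards [self_mem_nhdsWithin] with q hq
      have hq' : 0 < q := hq
      rw [indicator_of_mem (mem_Iic.2 hy), max_eq_left (by linarith), max_eq_left (by linarith),
        Pi.one_apply]
      field_simp
      ring
    · have hyx : 0 < y - x := by linarith
      filter_upwards [Ioo_mem_nhdsGT hyx] with q hq
      rw [indicator_of_notMem (by simpa using hy), max_eq_right (by linarith [hq.2]),
        max_eq_right (by linarith)]
      simp

theorem measureReal_Ioc_renewalMeasure [IsProbabilityMeasure F] (hF : F (Iio 0) = 0)
    (h0 : F {0}ᶜ ≠ 0) {x y : ℝ} (hxy : x ≤ y) : (renewalMeasure F).real (Ioc x y) =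
      (renewalMeasure F).real (Iic y) - (renewalMeasure F).real (Iic x) := by
  rw [← Iic_sdiff_Iic, measureReal_sdiff (Iic_subset_Iic.2 hxy) measurableSet_Iic
    (renewalMeasure_Iic_lt_top hF h0 y).ne]

theorem tendsto_hatMass_div [IsProbabilityMeasure F] (hF : F (Iio 0) = 0)
    (h0 : F {0}ᶜ ≠ 0) (x : ℝ) {p : ℝ} (hp : 0 ≤ p) :
    Tendsto (fun q : ℝ => hatMass F x p q / q) (𝓝[>] 0)
      (𝓝 ((renewalMeasure F).real (Ioc x (x + p)))) := by
  rw [measureReal_Ioc_renewalMeasure hF h0 (by linarith : x ≤ x + p)]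
  refine ((tendsto_rampMass_slope hF h0 (x + p)).sub (tendsto_rampMass_slope hF h0 x)).congr
    fun q => ?_
  rw [hatMass]
  ring

/-- Dominated convergence as `q → 0`: `expQuot q w / q` tends to `1` and is bounded by `1` at every
root, as `Re w ≥ 0`. -/
theorem measureReal_Ioc_eq_tsum [IsProbabilityMeasure F] (hF : F (Iio 0) = 0)
    (h0 : F {0}ᶜ ≠ 0) (hR : 0 < expRadius F) (hG : IsMeromorphicExtension F G)
    (hB : ∀ R₀ : ℝ, 0 < R₀ → BoundedAtVerticalInfinity G R₀)
    (hroots : ∀ w ∈ roots G, w.im = 0 ∧ deriv G w ≠ 0)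
    (hlim : liminf (nonLatticeSup G) atTop = 0) {x p : ℝ} (hx : 0 ≤ x)
    (hs : Summable fun w : roots G => ‖Complex.exp (-(x : ℂ) * w) / deriv G w‖) (hp : 0 ≤ p) :
    (((renewalMeasure F).real (Ioc x (x + p)) : ℝ) : ℂ) =
      ∑' w : roots G, Complex.exp (-(x : ℂ) * w) * expQuot p w / deriv G w := by
  have h1 := (Complex.continuous_ofReal.tendsto _).comp (tendsto_hatMass_div hF h0 x hp)
  refine tendsto_nhds_unique h1 ?_
  have h2 : Tendsto (fun q : ℝ => ∑' w : roots G, boxKernel x p q w / deriv G w / q) (𝓝[>] 0)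
      (𝓝 (∑' w : roots G, Complex.exp (-(x : ℂ) * w) * expQuot p w / deriv G w)) := by
    refine tendsto_tsum_of_dominated_convergence (hs.mul_left p) ?_ ?_
    · intro w
      have h3 := (tendsto_expQuot_div (w : ℂ)).const_mul
        (Complex.exp (-(x : ℂ) * w) * expQuot p w / deriv G w)
      rw [mul_one] at h3
      refine h3.congr fun q => ?_
      rw [boxKernel]
      ring
    · filter_upwards [self_mem_nhdsWithin] with q hq w
      have hq' : 0 < q := hq
      rw [norm_div, Complex.norm_real, Real.norm_of_nonneg hq'.le, div_le_iff₀ hq']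
      refine (norm_boxKernel_div_le hF h0 hR hG hp hq'.le w).trans_eq (by ring)
  refine h2.congr' ?_
  filter_upwards [self_mem_nhdsWithin] with q hq
  have hq' : 0 < q := hq
  rw [tsum_div_const, ← hatMass_eq_tsum hF h0 hR hG hB hroots hlim hx hs hp hq'.le]
  simp

/-- The complex density `∑ e^{-tw} / G'(w)` over the solutions of `G w = 1`. -/
noncomputable def rootSeries (G : ℂ → ℂ) (t : ℝ) : ℂ :=
  ∑' w : roots G, Complex.exp (-(t : ℂ) * w) / deriv G w

theorem norm_cexp_div_anti [IsProbabilityMeasure F] (hF : F (Iio 0) = 0)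
    (h0 : F {0}ᶜ ≠ 0) (hR : 0 < expRadius F) (hG : IsMeromorphicExtension F G) {s t : ℝ}
    (hst : s ≤ t) (w : roots G) : ‖Complex.exp (-(t : ℂ) * w) / deriv G w‖ ≤
      ‖Complex.exp (-(s : ℂ) * w) / deriv G w‖ := by
  have hre := hG.re_nonneg_of_eq_one hF h0 hR w.2
  have e : ∀ a : ℝ, (-(a : ℂ) * (w : ℂ)).re = -(a * (w : ℂ).re) := fun a => by simp
  rw [norm_div, norm_div, Complex.norm_exp, Complex.norm_exp, e, e]
  exact div_le_div_of_nonneg_right (Real.exp_le_exp.2 (by nlinarith)) (norm_nonneg _)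

theorem continuousAt_rootSeries [IsProbabilityMeasure F] (hF : F (Iio 0) = 0)
    (h0 : F {0}ᶜ ≠ 0) (hR : 0 < expRadius F) (hG : IsMeromorphicExtension F G) {s t : ℝ}
    (hst : s < t) (hs : Summable fun w : roots G => ‖Complex.exp (-(s : ℂ) * w) / deriv G w‖) :
    ContinuousAt (rootSeries G) t := by
  have h : ContinuousOn (rootSeries G) (Ici s) :=
    continuousOn_tsum (fun w => by fun_prop) hs
      fun w y hy => norm_cexp_div_anti hF h0 hR hG hy w
  exact h.continuousAt (Ici_mem_nhds hst)

theorem measureReal_Ioc_eq_integral [IsProbabilityMeasure F] (hF : F (Iio 0) = 0)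
    (h0 : F {0}ᶜ ≠ 0) (hR : 0 < expRadius F) (hG : IsMeromorphicExtension F G)
    (hB : ∀ R₀ : ℝ, 0 < R₀ → BoundedAtVerticalInfinity G R₀)
    (hroots : ∀ w ∈ roots G, w.im = 0 ∧ deriv G w ≠ 0)
    (hlim : liminf (nonLatticeSup G) atTop = 0) {x y : ℝ} (hx : 0 ≤ x)
    (hs : Summable fun w : roots G => ‖Complex.exp (-(x : ℂ) * w) / deriv G w‖) (hxy : x ≤ y) :
    (((renewalMeasure F).real (Ioc x y) : ℝ) : ℂ) = ∫ t in x..y, rootSeries G t := by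
  -- A summable family has countable support and no term vanishes; countability is needed for
  -- termwise integration.
  have hcount : Countable (roots G) := by
    rw [← Set.countable_univ_iff]
    refine hs.countable_support.mono fun w _ => ?_
    rw [Function.mem_support, norm_ne_zero_iff]
    exact div_ne_zero (Complex.exp_ne_zero _) (hroots w w.2).2
  obtain ⟨p, rfl⟩ : ∃ p, y = x + p := ⟨y - x, by ring⟩
  have hp : 0 ≤ p := by linarith
  rw [measureReal_Ioc_eq_tsum hF h0 hR hG hB hroots hlim hx hs hp]
  have hterm : ∀ w : roots G, ∫ t in x..(x + p), Complex.exp (-(t : ℂ) * w) / deriv G w =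
      Complex.exp (-(x : ℂ) * w) * expQuot p w / deriv G w := by
    intro w
    rw [intervalIntegral.integral_div, expQuot_eq_integral, ← intervalIntegral.integral_const_mul]
    congr 1
    have := intervalIntegral.integral_comp_add_left (a := 0) (b := p)
      (fun t : ℝ => Complex.exp (-(t : ℂ) * w)) x
    rw [add_zero] at this
    rw [← this]
    refine intervalIntegral.integral_congr fun t _ => ?_
    rw [← Complex.exp_add]
    congr 1
    push_cast
    ring
  simp only [← hterm]
  refine (intervalIntegral.hasSum_integral_of_dominated_convergence
    (F := fun (w : roots G) (t : ℝ) => Complex.exp (-(t : ℂ) * w) / deriv G w)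
    (fun (w : roots G) (_ : ℝ) => ‖Complex.exp (-(x : ℂ) * w) / deriv G w‖) ?_ ?_ ?_ ?_ ?_).tsum_eq
  · exact fun w => (by fun_prop : Continuous fun t : ℝ =>
      Complex.exp (-(t : ℂ) * w) / deriv G w).aestronglyMeasurable
  · refine fun w => Eventually.of_forall fun t ht => ?_
    rw [uIoc_of_le hxy] at ht
    exact norm_cexp_div_anti hF h0 hR hG ht.1.le w
  · exact Eventually.of_forall fun t _ => hs
  · exact intervalIntegrable_const
  · refine Eventually.of_forall fun t ht => ?_
    rw [uIoc_of_le hxy] at ht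
    exact (Summable.of_norm_bounded hs
      fun w => norm_cexp_div_anti hF h0 hR hG ht.1.le w).hasSum

/-- `S x` is the limit from the right of `m y / (y - x)`, and the nonnegative reals are closed in
`ℂ`. -/
theorem re_nonneg_and_im_eq_zero_of_integral {S : ℝ → ℂ} {m : ℝ → ℝ} {x : ℝ}
    (hm : ∀ y, x ≤ y → 0 ≤ m y) (h : ∀ y, x ≤ y → (m y : ℂ) = ∫ t in x..y, S t)
    (hc : ∀ y, x ≤ y → ContinuousAt S y) : 0 ≤ (S x).re ∧ (S x).im = 0 := by
  have hd : HasDerivWithinAt (fun b => ∫ t in x..b, S t) (S x) (Ici x) x := by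
    refine intervalIntegral.integral_hasDerivWithinAt_right (by simp) ?_
      (hc x le_rfl).continuousWithinAt
    exact ContinuousOn.stronglyMeasurableAtFilter_nhdsWithin
      (s := Ioi x)
      (fun y hy => (hc y (le_of_lt hy)).continuousWithinAt) measurableSet_Ioi x
  have hd' := hasDerivWithinAt_Ioi_iff_Ici.2 hd
  rw [hasDerivWithinAt_iff_tendsto_slope' self_notMem_Ioi] at hd'
  have hclosed : IsClosed {z : ℂ | 0 ≤ z.re ∧ z.im = 0} :=
    (isClosed_le continuous_const Complex.continuous_re).inter
      (isClosed_eq Complex.continuous_im continuous_const)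
  refine hclosed.mem_of_tendsto hd' ?_
  filter_upwards [self_mem_nhdsWithin] with y hy
  have hy' : x < y := hy
  rw [slope_def_module, intervalIntegral.integral_same, sub_zero, ← h y hy'.le]
  have h1 := hm y hy'.le
  have h2 : 0 ≤ (y - x)⁻¹ := inv_nonneg.2 (by linarith)
  rw [Complex.real_smul, ← Complex.ofReal_mul]
  exact ⟨mul_nonneg h2 h1, Complex.ofReal_im _⟩

theorem nonLattice_case [IsProbabilityMeasure F] (hF : F (Iio 0) = 0) (hR : 0 < expRadius F)
    (hG : IsMeromorphicExtension F G) (hL : ¬ IsLattice F)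
    (hB : ∀ R₀ : ℝ, 0 < R₀ → BoundedAtVerticalInfinity G R₀)
    (hroots : ∀ w ∈ roots G, w.im = 0 ∧ deriv G w ≠ 0)
    (hlim : liminf (nonLatticeSup G) atTop = 0) {x₀ : ℝ} (hx₀ : 0 ≤ x₀)
    (hsum : ∀ x : ℝ, x₀ < x → Summable fun w : {w : ℂ // w ∈ roots G ∧ w ≠ 0} =>
        ‖Complex.exp (-(x : ℂ) * w) / ((w : ℂ) * deriv G w)‖) :
    ∃ u : ℝ → ℝ,
      (∀ x : ℝ, x₀ < x → 0 ≤ u x ∧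
        HasSum (fun w : roots G =>
          -residue (fun z => Complex.exp (-(x : ℂ) * z) / (1 - G z)) w) (u x : ℂ) ∧
        HasSum (fun w : roots G =>
          Complex.exp (-(x : ℂ) * (w : ℂ)) / deriv G w) (u x : ℂ)) ∧
      (renewalMeasure F).restrict (Ioi x₀) =
        (volume.restrict (Ioi x₀)).withDensity (fun x => ENNReal.ofReal (u x)) := by
  have h0 := compl_singleton_ne_zero_of_not_isLattice hL
  have hs : ∀ x, x₀ < x → Summable fun w : roots G =>
      ‖Complex.exp (-(x : ℂ) * w) / deriv G w‖ := fun x hx =>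
    summable_norm_cexp_div_deriv hF h0 hR hG hroots hsum hx
  have hcont : ∀ x, x₀ < x → ContinuousAt (rootSeries G) x := fun x hx =>
    continuousAt_rootSeries hF h0 hR hG (by linarith : (x₀ + x) / 2 < x)
      (hs _ (by linarith))
  have hint : ∀ x y, x₀ < x → x ≤ y →
      (((renewalMeasure F).real (Ioc x y) : ℝ) : ℂ) = ∫ t in x..y, rootSeries G t :=
    fun x y hx hxy => measureReal_Ioc_eq_integral hF h0 hR hG hB hroots hlim (hx₀.trans hx.le)
      (hs x hx) hxy
  have hreal : ∀ x, x₀ < x → 0 ≤ (rootSeries G x).re ∧ (rootSeries G x).im = 0 := fun x hx =>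
    re_nonneg_and_im_eq_zero_of_integral (m := fun y => (renewalMeasure F).real (Ioc x y))
      (fun y _ => measureReal_nonneg) (fun y hy => hint x y hx hy)
      fun y hy => hcont y (hx.trans_le hy)
  have hcoe : ∀ x, x₀ < x → (((rootSeries G x).re : ℝ) : ℂ) = rootSeries G x := fun x hx =>
    Complex.ext rfl (by simp [(hreal x hx).2])
  refine ⟨fun x => (rootSeries G x).re, fun x hx => ?_, ?_⟩
  · have h1 : HasSum (fun w : roots G => Complex.exp (-(x : ℂ) * (w : ℂ)) / deriv G w)
        (((rootSeries G x).re : ℝ) : ℂ) := by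
      rw [hcoe x hx]
      exact (hs x hx).of_norm.hasSum
    refine ⟨(hreal x hx).1, ?_, h1⟩
    convert h1 using 2 with w
    rw [hG.residue_div (h := fun z => Complex.exp (-(x : ℂ) * z)) (by fun_prop) w.2
      (hroots w w.2).2, neg_neg]
  · have hIoc : ∀ x y, x₀ < x → x ≤ y → renewalMeasure F (Ioc x y) =
        ∫⁻ t in Ioc x y, ENNReal.ofReal (rootSeries G t).re := by
      intro x y hx hxy
      have hc : ContinuousOn (fun t => (rootSeries G t).re) (Icc x y) := fun t ht =>
        (Complex.continuous_re.continuousAt.comp (hcont t (hx.trans_le ht.1))).continuousWithinAt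
      have hi : IntegrableOn (fun t => (rootSeries G t).re) (Ioc x y) :=
        (hc.integrableOn_Icc).mono_set Ioc_subset_Icc_self
      rw [← ofReal_integral_eq_lintegral_ofReal hi]
      · have h1 : (renewalMeasure F).real (Ioc x y) = ∫ t in Ioc x y, (rootSeries G t).re := by
          have h2 := hint x y hx hxy
          rw [intervalIntegral.integral_of_le hxy, setIntegral_congr_fun measurableSet_Ioc
            (fun t ht => (hcoe t (hx.trans ht.1)).symm), integral_complex_ofReal] at h2
          exact_mod_cast h2
        rw [← h1, Measure.real, ENNReal.ofReal_toReal]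
        exact ((measure_mono Ioc_subset_Iic_self).trans_lt
          (renewalMeasure_Iic_lt_top hF h0 y)).ne
      · filter_upwards [ae_restrict_mem measurableSet_Ioc] with t ht
        exact (hreal t (hx.trans ht.1)).1
    rw [← restrict_withDensity measurableSet_Ioi]
    -- The series may diverge at `x₀`, so the measures are compared on `(v n, ∞)` with `v n`
    -- decreasing to `x₀`. There half-open intervals determine them.
    obtain ⟨v, -, hv, hvt⟩ := exists_seq_strictAnti_tendsto x₀
    have hU : Ioi x₀ = ⋃ n, Ioi (v n) := by
      ext t
      simp only [mem_Ioi, mem_iUnion]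
      constructor
      · intro ht
        exact (hvt.eventually (gt_mem_nhds ht)).exists
      · rintro ⟨n, hn⟩
        exact (hv n).trans hn
    rw [hU, Measure.restrict_iUnion_congr]
    intro n
    have hIoi : ∀ a b : ℝ, Ioc a b ∩ Ioi (v n) = Ioc (max a (v n)) b := fun a b => by
      ext t
      simp only [mem_inter_iff, mem_Ioc, mem_Ioi, max_lt_iff]
      tauto
    refine Measure.ext_of_Ioc' _ _ ?_ ?_
    · intro a b _
      rw [Measure.restrict_apply measurableSet_Ioc, hIoi]
      exact ((measure_mono Ioc_subset_Iic_self).trans_lt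
        (renewalMeasure_Iic_lt_top hF h0 b)).ne
    · intro a b _
      rw [Measure.restrict_apply measurableSet_Ioc, Measure.restrict_apply measurableSet_Ioc, hIoi,
        withDensity_apply _ measurableSet_Ioc]
      rcases le_total (max a (v n)) b with h | h
      · exact hIoc _ _ ((hv n).trans_le (le_max_right _ _)) h
      · simp [Ioc_eq_empty_of_le h]

end NonLattice

end Renewal

theorem mainTheorem6 (F : Measure ℝ) [IsProbabilityMeasure F] (hF : F (Iio 0) = 0)
    (hR : 0 < Renewal.expRadius F) (G : ℂ → ℂ) (hG : Renewal.IsMeromorphicExtension F G) :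
    -- lattice case, mesh `1`
    (Renewal.SupportedOnMultiples F 1 →
      liminf (Renewal.latticeSup G 1) atTop = 0 →
      ∃ u : ℕ → ℝ, (∀ k, 0 ≤ u k) ∧
        Renewal.renewalMeasure F =
          Measure.sum (fun k : ℕ => ENNReal.ofReal (u k) • Measure.dirac (k : ℝ)) ∧
        ∀ k m : ℕ, (1 ≤ k ∧ m = 1 ∨
            k = 0 ∧ m = 0 ∧ liminf (Renewal.latticeSup G 0) atTop = 0) →
          Renewal.IsOrderedRootSum G m
            (fun w => -Renewal.residue (fun z => Complex.exp (-(k : ℂ) * z) / (1 - G z)) w)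
            (u k : ℂ) ∧
          ((∀ w ∈ Renewal.stripRoots G, deriv G w ≠ 0) →
            Renewal.IsOrderedRootSum G m
              (fun w => Complex.exp (-(k : ℂ) * w) / deriv G w) (u k : ℂ))) ∧
    -- non-lattice case
    (¬ Renewal.IsLattice F →
      (∀ R₀ : ℝ, 0 < R₀ → Renewal.BoundedAtVerticalInfinity G R₀) →
      (∀ w ∈ Renewal.roots G, w.im = 0 ∧ deriv G w ≠ 0) →
      liminf (Renewal.nonLatticeSup G) atTop = 0 →
      ∀ x₀ : ℝ, 0 ≤ x₀ →
      (∀ x : ℝ, x₀ < x → Summable fun w : {w : ℂ // w ∈ Renewal.roots G ∧ w ≠ 0} =>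
        ‖Complex.exp (-(x : ℂ) * w) / ((w : ℂ) * deriv G w)‖) →
      ∃ u : ℝ → ℝ,
        (∀ x : ℝ, x₀ < x → 0 ≤ u x ∧
          HasSum (fun w : Renewal.roots G =>
            -Renewal.residue (fun z => Complex.exp (-(x : ℂ) * z) / (1 - G z)) w) (u x : ℂ) ∧
          HasSum (fun w : Renewal.roots G =>
            Complex.exp (-(x : ℂ) * (w : ℂ)) / deriv G w) (u x : ℂ)) ∧
        (Renewal.renewalMeasure F).restrict (Ioi x₀) =
          (volume.restrict (Ioi x₀)).withDensity (fun x => ENNReal.ofReal (u x))) :=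
  ⟨fun hS hlim => Renewal.lattice_case hF hR hG hS hlim,
    fun hL hB hroots hlim _ hx₀ hsum =>
      Renewal.nonLattice_case hF hR hG hL hB hroots hlim hx₀ hsum⟩
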